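/- \textbf{Setting.} Let $C$ be a set of $n\ge 1$ agents, who are also the alternatives, and let $1\le k$ and $1\le \ell\le n$. Each agent $i$ holds a total order $\succeq_i$ on $C$, and $\sigma=(\succeq_i)_{i\in C}$. Let $d$ be a (pseudo)metric on $C$ that is consistent with $\sigma$: $a\succeq_i b$ implies $d(i,a)\le d(i,b)$. For nonempty $S\subseteq C$ let $d(j,S)=\min_{a\in S}d(j,a)$, let $\mathrm{Top}_\ell(v)$ be the sum of the $\ell$ largest entries of a vector $v\in\mathbb{R}_{\ge0}^C$, and let $$\mathrm{OPT}_\ell=\min_{\emptyset\ne S\subseteq C,\ |S|\le k}\mathrm{Top}_\ell\bigl((d(j,S))_{j\in C}\bigr).$$ A mechanism receives $n,k,\ell,\sigma$, but it can access $d$ only through adaptive value queries, each of which asks one agent $i$ for one value $d(i,a)$. Mechanisms are programs of a real-number random access machine. It has unit-cost additions, subtractions and comparisons, it reads $\sigma$ as an input table, and it can draw one of $m$ indices with probability proportional to $m$ given nonnegative weights, at a cost of $m+1$ steps (uniformly if all weights vanish). Queries are counted with repetition. The programs, the polynomials and the constants in $O(\cdot)$ below do not depend on $n,k,\ell,\sigma,d$.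 \textbf{Theorem.} (a) There is a deterministic mechanism that runs in time polynomial in $n$ and $k$ and uses $O(k)$ queries per agent and $O(k^2)$ queries in total. It carries out the farthest-point rule: it opens centers $s_1,\dots,s_k$ with $s_1$ arbitrary and $s_{t+1}$ an agent that maximizes $d(\cdot,\{s_1,\dots,s_t\})$. It returns $B_1=\ell\cdot\max_{j\in C}d(j,\{s_1,\dots,s_k\})$, and $$\mathrm{OPT}_\ell\le B_1\le 2\ell\cdot\mathrm{OPT}_\ell .$$ (b) There is a randomized mechanism that, for every outcome of its random draws, runs in time polynomial in $n$ and $k$ and uses $O(k)$ queries per agent. It carries out $k$-means++ with unsquared distances: it opens centers $s_1,\dots,s_k$, where $s_1$ is uniform on $C$ and, given $s_1,\dots,s_t$, the center $s_{t+1}$ is agent $j$ with probability proportional to $d(j,\{s_1,\dots,s_t\})$ (uniform if all these distances are $0$). It returns $B_n=\sum_{j\in C}d(j,\{s_1,\dots,s_k\})$, and with probability at least $1/2$ $$\mathrm{OPT}_\ell\le B_n\le 8(\ln k+2)\cdot\frac n\ell\cdot\mathrm{OPT}_\ell .$$ -/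

import Mathlib

open scoped ENNReal

noncomputable section

namespace KClustering

/-! ### Instances of the `ℓ`-centrum problem (agents = alternatives = `Fin n`) -/

/-- A preference profile: agent `i` holds a total order on the alternatives, given by the
ranking `σ i`; `σ i a` is the position of alternative `a` (position `0` is the top choice). -/
abbrev Profile (n : ℕ) : Type := Fin n → Equiv.Perm (Fin n)

/-- Agent `i` prefers `a` to `b`, i.e. `a ⪰ᵢ b`. -/
def Profile.Prefers {n : ℕ} (σ : Profile n) (i a b : Fin n) : Prop := σ i a ≤ σ i b

/-- The distance function `d` is consistent with the profile `σ`. -/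
def Consistent {n : ℕ} (d : PseudoMetric (Fin n) ℝ) (σ : Profile n) : Prop :=
  ∀ i a b : Fin n, σ.Prefers i a b → d i a ≤ d i b

/-- `d(j, S) = min_{a ∈ S} d(j, a)` for nonempty `S` (and, by convention, `0` for `S = ∅`). -/
def distTo {n : ℕ} (d : PseudoMetric (Fin n) ℝ) (S : Finset (Fin n)) (j : Fin n) : ℝ :=
  if h : S.Nonempty then S.inf' h (fun a => d j a) else 0

/-- The `Top_ℓ`-cost of a vector: the sum of its `ℓ` largest entries. -/
def topCost {n : ℕ} (l : ℕ) (v : Fin n → ℝ) : ℝ :=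
  (((Finset.univ.val.map v).sort (fun x y => x ≥ y)).take l).sum

/-- `OPT_ℓ`: the minimum of `Top_ℓ(d(C, S))` over nonempty committees `S` of size at most `k`. -/
def opt {n : ℕ} (d : PseudoMetric (Fin n) ℝ) (k l : ℕ) : ℝ :=
  sInf {c : ℝ | ∃ S : Finset (Fin n), S.Nonempty ∧ S.card ≤ k ∧ c = topCost l (distTo d S)}

/-- The `k`-center cost `max_j d(j, S)`. -/
def centerCost {n : ℕ} (d : PseudoMetric (Fin n) ℝ) (S : Finset (Fin n)) : ℝ :=
  ⨆ j : Fin n, distTo d S j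

/-- The `k`-median cost `∑_j d(j, S)`. -/
def medianCost {n : ℕ} (d : PseudoMetric (Fin n) ℝ) (S : Finset (Fin n)) : ℝ :=
  ∑ j : Fin n, distTo d S j

/-! ### The two center-selection rules -/

/-- Farthest-point rule: `s` lists centers in the order of opening, the first one is arbitrary,
and each later one is an agent that is farthest from the centers opened before it. -/
def IsFarthestPointRun {n : ℕ} (d : PseudoMetric (Fin n) ℝ) (s : List (Fin n)) : Prop :=
  ∀ (t : ℕ) (ht : t < s.length), 0 < t →
    ∀ j : Fin n, distTo d (s.take t).toFinset j ≤ distTo d (s.take t).toFinset s[t]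

open Classical in
/-- The distribution on a finite type that is proportional to the (positive parts of the)
weights `w`. If no weight is positive, it is the uniform distribution. -/
def proportional {α : Type} [Fintype α] [Nonempty α] (w : α → ℝ) : PMF α :=
  if h : (∑' a, ENNReal.ofReal (w a)) ≠ 0 then
    PMF.normalize (fun a => ENNReal.ofReal (w a)) h
      (by rw [tsum_fintype]; exact ENNReal.sum_ne_top.2 fun _ _ => ENNReal.ofReal_ne_top)
  else PMF.uniformOfFintype α

/-- The law of the first `t` centers opened by `k`-means++ with (unsquared) distances: the first
center is uniform, and each later center is agent `j` with probability proportional to the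
distance from `j` to the centers opened so far (uniform if all these distances are `0`). -/
def kMeansPPLaw {n : ℕ} [NeZero n] (d : PseudoMetric (Fin n) ℝ) : ℕ → PMF (List (Fin n))
  | 0 => PMF.pure []
  | t + 1 => (kMeansPPLaw d t).bind fun s =>
      (proportional (if s = [] then fun _ => 1 else distTo d s.toFinset)).map fun j => s ++ [j]

/-! ### Machine model

Programs of a structured random access machine over natural numbers and reals. The memory
consists of arrays `N₀, N₁, …` of natural numbers and arrays `R₀, R₁, …` of reals, all with index
set `ℕ`. The arithmetic operations are addition and subtraction only (on naturals, subtraction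
truncates), so that no number grows more than exponentially in the number of steps. The ranking
table of the preference profile is read-only input. The distance function can be accessed only by
value queries; each of them is logged. A random draw from `m` given weights costs `m + 1` steps.
-/

inductive NatExpr : Type
  | lit (v : ℕ)
  | read (a : ℕ) (idx : NatExpr)
  | add (e₁ e₂ : NatExpr)
  | sub (e₁ e₂ : NatExpr)
  /-- the position of alternative `alt` in the ranking of agent `agent` -/
  | rank (agent alt : NatExpr)

inductive RealExpr : Type
  | ofNat (e : NatExpr)
  | read (a : ℕ) (idx : NatExpr)
  | add (e₁ e₂ : RealExpr)
  | sub (e₁ e₂ : RealExpr)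

inductive BoolExpr : Type
  | natLE (e₁ e₂ : NatExpr)
  | realLE (e₁ e₂ : RealExpr)
  | not (b : BoolExpr)
  | and (b₁ b₂ : BoolExpr)

inductive Prog : Type
  | skip
  /-- `N_a[idx] := e` -/
  | setNat (a : ℕ) (idx e : NatExpr)
  /-- `R_a[idx] := e` -/
  | setReal (a : ℕ) (idx : NatExpr) (e : RealExpr)
  /-- `R_a[idx] := d(agent, alt)`, a value query put to `agent` -/
  | query (a : ℕ) (idx agent alt : NatExpr)
  /-- `N_a[idx] :=` a random index `j < m`, drawn with probability proportional to `R_w[j]` -/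
  | sample (a : ℕ) (idx : NatExpr) (w : ℕ) (m : NatExpr)
  | seq (p₁ p₂ : Prog)
  | ite (b : BoolExpr) (p₁ p₂ : Prog)
  /-- `for N_x[0] = 0, …, e - 1 do p`, where `e` is evaluated once, on entry -/
  | forLoop (x : ℕ) (e : NatExpr) (p : Prog)

/-- A configuration: the memory, the log of all value queries made so far (pairs of an agent and
an alternative, with repetitions), and the number of steps made so far. -/
structure Config (n : ℕ) where
  nat : ℕ → ℕ → ℕ
  real : ℕ → ℕ → ℝ
  log : List (Fin n × Fin n)
  steps : ℕ

namespace Config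

variable {n : ℕ}

def setNat (c : Config n) (a i v : ℕ) : Config n :=
  { c with nat := fun a' i' => if a' = a ∧ i' = i then v else c.nat a' i' }

def setReal (c : Config n) (a i : ℕ) (v : ℝ) : Config n :=
  { c with real := fun a' i' => if a' = a ∧ i' = i then v else c.real a' i' }

def tick (c : Config n) (m : ℕ) : Config n := { c with steps := c.steps + m }

/-- Query `d(i, a)` and store the answer in `R_b[idx]`; for numbers that denote no agent, nothing
is queried and `0` is stored. -/
def ask (c : Config n) (d : PseudoMetric (Fin n) ℝ) (b idx i a : ℕ) : Config n :=
  if h : i < n ∧ a < n then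
    { c.setReal b idx (d ⟨i, h.1⟩ ⟨a, h.2⟩) with log := (⟨i, h.1⟩, ⟨a, h.2⟩) :: c.log }
  else c.setReal b idx 0

/-- The number of value queries put to agent `i`. -/
def queriesTo (c : Config n) (i : Fin n) : ℕ := c.log.countP fun q => q.1 = i

/-- The total number of value queries. -/
def totalQueries (c : Config n) : ℕ := c.log.length

/-- The initial configuration: `N₀[0] = n`, `N₁[0] = k`, `N₂[0] = ℓ`, all else is `0`. -/
def init (n k l : ℕ) : Config n where
  nat := fun a i =>
    if i = 0 then (if a = 0 then n else if a = 1 then k else if a = 2 then l else 0) else 0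
  real := fun _ _ => 0
  log := []
  steps := 0

/-- The first `k` entries of `N₃`, where a program leaves the centers it has opened. -/
def centers (c : Config n) (k : ℕ) : List ℕ := (List.range k).map (c.nat 3)

/-- The number `R₀[0]`, where a program leaves its estimate. -/
def estimate (c : Config n) : ℝ := c.real 0 0

end Config

variable {n : ℕ}

def NatExpr.eval (σ : Profile n) (c : Config n) : NatExpr → ℕ
  | lit v => v
  | read a idx => c.nat a (idx.eval σ c)
  | add e₁ e₂ => e₁.eval σ c + e₂.eval σ c
  | sub e₁ e₂ => e₁.eval σ c - e₂.eval σ c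
  | rank i a =>
      if h : i.eval σ c < n ∧ a.eval σ c < n then (σ ⟨i.eval σ c, h.1⟩ ⟨a.eval σ c, h.2⟩ : ℕ) else 0

def RealExpr.eval (σ : Profile n) (c : Config n) : RealExpr → ℝ
  | ofNat e => (e.eval σ c : ℝ)
  | read a idx => c.real a (idx.eval σ c)
  | add e₁ e₂ => e₁.eval σ c + e₂.eval σ c
  | sub e₁ e₂ => e₁.eval σ c - e₂.eval σ c

def BoolExpr.eval (σ : Profile n) (c : Config n) : BoolExpr → Prop
  | natLE e₁ e₂ => e₁.eval σ c ≤ e₂.eval σ c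
  | realLE e₁ e₂ => e₁.eval σ c ≤ e₂.eval σ c
  | not b => ¬ b.eval σ c
  | and b₁ b₂ => b₁.eval σ c ∧ b₂.eval σ c

/-- A random index `j < m`, drawn with probability proportional to `w j` (`0` if `m = 0`). -/
def drawIndex (m : ℕ) (w : ℕ → ℝ) : PMF ℕ :=
  match m with
  | 0 => PMF.pure 0
  | m + 1 => (proportional fun j : Fin (m + 1) => w j).map fun j => (j : ℕ)

open Classical in
/-- The distribution of the final configuration of a program that is started in a given
configuration, on an instance with profile `σ` and distance function `d`. -/
def Prog.exec (σ : Profile n) (d : PseudoMetric (Fin n) ℝ) : Prog → Config n → PMF (Config n)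
  | skip, c => PMF.pure (c.tick 1)
  | setNat a idx e, c => PMF.pure ((c.setNat a (idx.eval σ c) (e.eval σ c)).tick 1)
  | setReal a idx e, c => PMF.pure ((c.setReal a (idx.eval σ c) (e.eval σ c)).tick 1)
  | query a idx i b, c =>
      PMF.pure ((c.ask d a (idx.eval σ c) (i.eval σ c) (b.eval σ c)).tick 1)
  | sample a idx w m, c =>
      (drawIndex (m.eval σ c) (c.real w)).map fun j =>
        (c.setNat a (idx.eval σ c) j).tick (m.eval σ c + 1)
  | seq p₁ p₂, c => (p₁.exec σ d c).bind fun c' => p₂.exec σ d c'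
  | ite b p₁ p₂, c => if b.eval σ c then p₁.exec σ d (c.tick 1) else p₂.exec σ d (c.tick 1)
  | forLoop x e p, c =>
      (List.range (e.eval σ c)).foldlM (m := PMF)
        (fun c' t => p.exec σ d ((c'.setNat x 0 t).tick 1)) (c.tick 1)

/-- The distribution of the final configuration of a program on the instance `(n, k, ℓ, σ, d)`. -/
def Prog.run (P : Prog) (k l : ℕ) (σ : Profile n) (d : PseudoMetric (Fin n) ℝ) :
    PMF (Config n) :=
  P.exec σ d (Config.init n k l)

end KClustering

end

/-!
Both mechanisms rest on the fact that the rankings alone tell every agent's nearest open center, and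
that, by symmetry of the distance, the agent of a cluster that is farthest from its center is the
one that the center itself ranks last in the cluster.

**Farthest point.** In each round, one agent per cluster, the one ranked last by the center, is
asked for its distance to that center (`runs_findFarthest`). Clusters are indexed by the number of
the center, so they are disjoint even if centers repeat, and no agent is asked twice in a round. For
the approximation, the `k` centers and an agent farthest from them are `k + 1` points with pairwise
distances at least the cost `r` of the solution. Two of them share their nearest center in an
optimal set, hence `r` is at most twice the optimal `k`-center cost (`centerCost_le_two_mul`). The
factor `2ℓ` follows as `Top_ℓ` lies between the maximum and `ℓ` times the maximum.

**`k`-means++.** Each agent is asked, in each round, for the distance to its nearest center, so the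
sampling weights are exact; `coupled_kMeansProg` couples the run of the program with the sampling
rule. The expected cost is bounded as in the analysis of Arthur and Vassilvitskii. A center drawn in
a cluster `A` proportionally to the distance costs at most four times as much for `A` as any fixed
center (`sum_distTo_mul_sum_distTo_insert_le`). An induction on the number of remaining draws, over
all sets `U` of clusters that are considered as uncovered, bounds the expected final cost by
`potential` (`expCost_le_potential`): a draw that hits a covered cluster is paid for by the next
term of the harmonic sum, and a draw that hits an uncovered one removes from `U`, in expectation, at
least the average cluster cost, by the Cauchy-Schwarz inequality. Clusters may be empty, so that
exactly `k` of them can be assumed. This gives the factor `4 (ln k + 2)` in expectation against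
every committee. Since `Top_ℓ` is at least the fraction `ℓ / n` of the sum of all entries
(`mul_sum_le_mul_topCost`), Markov's inequality gives the bound with probability at least `1 / 2`.
-/

noncomputable section

namespace KClustering

/-! ### Distances to a set of centers -/

section Dist

variable {n : ℕ} (d : PseudoMetric (Fin n) ℝ)

theorem distTo_nonneg (S : Finset (Fin n)) (j : Fin n) : 0 ≤ distTo d S j := by
  unfold distTo
  split_ifs with h
  · exact (Finset.le_inf'_iff h _).2 fun a _ => d.nonneg j a
  · exact le_rfl

theorem distTo_le {S : Finset (Fin n)} {a : Fin n} (ha : a ∈ S) (j : Fin n) :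
    distTo d S j ≤ d j a := by
  have h : S.Nonempty := ⟨a, ha⟩
  rw [distTo, dif_pos h]
  exact Finset.inf'_le _ ha

theorem exists_distTo_eq {S : Finset (Fin n)} (hS : S.Nonempty) (j : Fin n) :
    ∃ a ∈ S, distTo d S j = d j a := by
  rw [distTo, dif_pos hS]
  exact Finset.exists_mem_eq_inf' hS _

theorem distTo_eq_of_forall_le {S : Finset (Fin n)} {a j : Fin n} (ha : a ∈ S)
    (h : ∀ b ∈ S, d j a ≤ d j b) : distTo d S j = d j a := by
  obtain ⟨b, hb, hab⟩ := exists_distTo_eq d ⟨a, ha⟩ j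
  exact le_antisymm (distTo_le d ha j) (hab ▸ h b hb)

theorem distTo_anti {S T : Finset (Fin n)} (hS : S.Nonempty) (h : S ⊆ T) (j : Fin n) :
    distTo d T j ≤ distTo d S j := by
  obtain ⟨a, ha, he⟩ := exists_distTo_eq d hS j
  rw [he]
  exact distTo_le d (h ha) j

theorem distTo_insert_le (S : Finset (Fin n)) (a j : Fin n) :
    distTo d (insert a S) j ≤ d j a :=
  distTo_le d (Finset.mem_insert_self a S) j

theorem distTo_triangle {S : Finset (Fin n)} (hS : S.Nonempty) (a x : Fin n) :
    distTo d S a ≤ d a x + distTo d S x := by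
  obtain ⟨b, hb, he⟩ := exists_distTo_eq d hS x
  rw [he]
  exact (distTo_le d hb a).trans (d.triangle a x b)

theorem distTo_le_centerCost (S : Finset (Fin n)) (j : Fin n) :
    distTo d S j ≤ centerCost d S :=
  le_ciSup (f := fun j => distTo d S j) (Set.finite_range _).bddAbove j

theorem centerCost_le [NeZero n] {S : Finset (Fin n)} {r : ℝ} (h : ∀ j, distTo d S j ≤ r) :
    centerCost d S ≤ r :=
  ciSup_le h

end Dist

/-! ### The `Top_ℓ`-cost and the optimum -/

section Top

variable {n : ℕ}

theorem exists_sorted_topCost (v : Fin n → ℝ) :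
    ∃ L : List ℝ, L.Pairwise (fun x y => x ≥ y) ∧ L.length = n ∧ L.sum = ∑ j, v j ∧
      (∀ x, x ∈ L ↔ ∃ j, v j = x) ∧ ∀ l, topCost l v = (L.take l).sum := by
  refine ⟨(Finset.univ.val.map v).sort (fun x y => x ≥ y), ?_, ?_, ?_, ?_, fun l => rfl⟩
  · exact Multiset.pairwise_sort _ _
  · simp
  · rw [← Multiset.sum_coe, Multiset.sort_eq]
    rfl
  · intro x
    simp

theorem topCost_le_sum {v : Fin n → ℝ} (hv : ∀ j, 0 ≤ v j) (l : ℕ) :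
    topCost l v ≤ ∑ j, v j := by
  obtain ⟨L, -, -, hsum, hmem, htop⟩ := exists_sorted_topCost v
  rw [htop, ← hsum, ← List.sum_take_add_sum_drop L l]
  refine le_add_of_nonneg_right (List.sum_nonneg fun x hx => ?_)
  obtain ⟨j, rfl⟩ := (hmem x).1 (List.mem_of_mem_drop hx)
  exact hv j

theorem topCost_le_mul {v : Fin n → ℝ} {r : ℝ} (hr : ∀ j, v j ≤ r) {l : ℕ} (hl : l ≤ n) :
    topCost l v ≤ l * r := by
  obtain ⟨L, -, hlen, -, hmem, htop⟩ := exists_sorted_topCost v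
  have h := List.sum_le_card_nsmul (L.take l) r fun x hx => by
    obtain ⟨j, rfl⟩ := (hmem x).1 (List.mem_of_mem_take hx)
    exact hr j
  rw [List.length_take, hlen, min_eq_left hl, nsmul_eq_mul] at h
  rw [htop]
  exact h

theorem le_topCost {v : Fin n → ℝ} (hv : ∀ j, 0 ≤ v j) {l : ℕ} (hl : 1 ≤ l) (j : Fin n) :
    v j ≤ topCost l v := by
  obtain ⟨L, hsort, hlen, -, hmem, htop⟩ := exists_sorted_topCost v
  rw [htop]
  obtain ⟨m, rfl⟩ : ∃ m, l = m + 1 := ⟨l - 1, by omega⟩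
  cases L with
  | nil => exact absurd ((hmem (v j)).2 ⟨j, rfl⟩) (by simp)
  | cons x L =>
    have h1 : v j ≤ x := by
      rcases List.mem_cons.1 ((hmem (v j)).2 ⟨j, rfl⟩) with h | h
      · exact h.le
      · exact (List.pairwise_cons.1 hsort).1 _ h
    have h2 : 0 ≤ (L.take m).sum := List.sum_nonneg fun y hy => by
      obtain ⟨i, rfl⟩ := (hmem y).1 (List.mem_cons_of_mem _ (List.mem_of_mem_take hy))
      exact hv i
    rw [List.take_succ_cons, List.sum_cons]
    linarith

/-- The average of the `ℓ` largest entries is at least the average of all entries. -/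
theorem mul_sum_le_mul_topCost (v : Fin n → ℝ) {l : ℕ} (hl : 1 ≤ l) (hn : l ≤ n) :
    l * ∑ j, v j ≤ n * topCost l v := by
  obtain ⟨L, hsort, hlen, hsum, -, htop⟩ := exists_sorted_topCost v
  have hll : l - 1 < L.length := by omega
  -- the smallest of the `ℓ` largest entries separates the two parts of the sorted list
  have h1 := List.card_nsmul_le_sum (L.take l) L[l - 1] fun x hx => by
    obtain ⟨i, hi, rfl⟩ := List.mem_iff_getElem.1 hx
    rw [List.length_take] at hi
    rw [List.getElem_take]
    rcases Nat.lt_or_ge i (l - 1) with h | h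
    · exact List.pairwise_iff_getElem.1 hsort i (l - 1) (by omega) hll h
    · have : i = l - 1 := by omega
      subst this
      exact le_rfl
  have h2 := List.sum_le_card_nsmul (L.drop l) L[l - 1] fun x hx => by
    obtain ⟨i, hi, rfl⟩ := List.mem_iff_getElem.1 hx
    rw [List.length_drop] at hi
    rw [List.getElem_drop]
    exact List.pairwise_iff_getElem.1 hsort (l - 1) (l + i) hll (by omega) (by omega)
  rw [List.length_take, hlen, min_eq_left hn, nsmul_eq_mul] at h1
  rw [List.length_drop, hlen, nsmul_eq_mul, Nat.cast_sub hn] at h2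
  have hln : (l : ℝ) ≤ n := by exact_mod_cast hn
  have h3 := mul_le_mul_of_nonneg_left h1 (sub_nonneg.2 hln)
  have h4 := mul_le_mul_of_nonneg_left h2 (Nat.cast_nonneg (α := ℝ) l)
  rw [htop, ← hsum, ← List.sum_take_add_sum_drop L l]
  nlinarith

variable (d : PseudoMetric (Fin n) ℝ)

theorem opt_le {S : Finset (Fin n)} (hS : S.Nonempty) {k : ℕ} (hk : S.card ≤ k) (l : ℕ) :
    opt d k l ≤ topCost l (distTo d S) := by
  refine csInf_le ⟨0, ?_⟩ ⟨S, hS, hk, rfl⟩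
  rintro _ ⟨T, -, -, rfl⟩
  obtain ⟨L, -, -, -, hmem, htop⟩ := exists_sorted_topCost (distTo d T)
  rw [htop]
  refine List.sum_nonneg fun x hx => ?_
  obtain ⟨j, rfl⟩ := (hmem x).1 (List.mem_of_mem_take hx)
  exact distTo_nonneg d T j

theorem le_mul_opt [NeZero n] {k l : ℕ} (hk : 1 ≤ k) {b r : ℝ} (hr : 0 < r)
    (h : ∀ S : Finset (Fin n), S.Nonempty → S.card ≤ k → b ≤ r * topCost l (distTo d S)) :
    b ≤ r * opt d k l := by
  rw [← div_le_iff₀' hr]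
  refine le_csInf ⟨_, {0}, ⟨0, by simp⟩, by simpa using hk, rfl⟩ ?_
  rintro _ ⟨S, hS, hSk, rfl⟩
  rw [div_le_iff₀' hr]
  exact h S hS hSk

end Top

/-! ### The farthest-point rule is a 2-approximation for `k`-center -/

section Farthest

variable {n : ℕ} (d : PseudoMetric (Fin n) ℝ)

/-- The `k` opened centers together with an agent that is farthest from them have pairwise
distances at least `centerCost d S`; two of these `k + 1` agents share their nearest center in
any competing set of at most `k` centers. -/
theorem centerCost_le_two_mul [NeZero n] {s : List (Fin n)} (hs : IsFarthestPointRun d s)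
    {S : Finset (Fin n)} (hS : S.Nonempty) (hSk : S.card ≤ s.length) :
    centerCost d s.toFinset ≤ 2 * centerCost d S := by
  refine centerCost_le d fun p => ?_
  set r := distTo d s.toFinset p with hr
  let q : Fin (s.length + 1) → Fin n := fun i => if h : i.1 < s.length then s[i.1] else p
  have hfar : ∀ i j : Fin (s.length + 1), i < j → r ≤ d (q j) (q i) := by
    intro i j hij
    have hi : i.1 < s.length := by omega
    have hqi : q i = s[i.1] := dif_pos hi
    by_cases hj : j.1 < s.length
    · have hqj : q j = s[j.1] := dif_pos hj
      have hmem : q i ∈ (s.take j.1).toFinset := by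
        rw [List.mem_toFinset, List.mem_take_iff_getElem, hqi]
        exact ⟨i.1, by omega, rfl⟩
      calc r ≤ distTo d (s.take j.1).toFinset p := by
            refine distTo_anti d ⟨q i, hmem⟩ (fun x hx => ?_) p
            exact List.mem_toFinset.2 (List.mem_of_mem_take (List.mem_toFinset.1 hx))
        _ ≤ distTo d (s.take j.1).toFinset s[j.1] := hs j.1 hj (by omega) p
        _ ≤ d (q j) (q i) := by rw [← hqj]; exact distTo_le d hmem _
    · have hqj : q j = p := dif_neg hj
      rw [hqj]
      exact distTo_le d (by rw [hqi]; simp) p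
  choose f hf using fun i => exists_distTo_eq d hS (q i)
  obtain ⟨i, -, j, -, hij, hfe⟩ := Finset.exists_ne_map_eq_of_card_lt_of_maps_to
    (s := (Finset.univ : Finset (Fin (s.length + 1)))) (t := S) (f := f)
    (by simpa using by omega) (fun i _ => (hf i).1)
  have key : ∀ i j : Fin (s.length + 1), i < j → f i = f j → r ≤ 2 * centerCost d S := by
    intro i j hij hfe
    have h1 := distTo_le_centerCost d S (q i)
    have h2 := distTo_le_centerCost d S (q j)
    have h3 := d.triangle (q j) (f j) (q i)
    rw [(hf i).2, hfe] at h1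
    rw [(hf j).2] at h2
    rw [d.symm (f j) (q i)] at h3
    linarith [hfar i j hij]
  rcases lt_or_gt_of_ne hij with h | h
  · exact key i j h hfe
  · exact key j i h hfe.symm

theorem farthestPoint_sandwich [NeZero n] {k l : ℕ} (hk : 1 ≤ k) (hl : 1 ≤ l) (hln : l ≤ n)
    {s : List (Fin n)} (hs : IsFarthestPointRun d s) (hlen : s.length = k) :
    opt d k l ≤ l * centerCost d s.toFinset ∧
      l * centerCost d s.toFinset ≤ 2 * l * opt d k l := by
  have hne : s.toFinset.Nonempty := by
    rw [List.toFinset_nonempty_iff]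
    rintro rfl
    simp at hlen
    omega
  have hl0 : (0 : ℝ) < l := by exact_mod_cast hl
  constructor
  · exact (opt_le d hne (hlen ▸ List.toFinset_card_le s) l).trans
      (topCost_le_mul (distTo_le_centerCost d _) hln)
  · refine le_mul_opt d hk (by positivity) fun S hS hSk => ?_
    have h1 := centerCost_le_two_mul d hs hS (by omega)
    have h2 : centerCost d S ≤ topCost l (distTo d S) :=
      centerCost_le d (le_topCost (distTo_nonneg d S) hl)
    nlinarith

end Farthest

/-! ### Sampling proportionally to the distance -/

section Proportional

variable {α : Type} [Fintype α] [Nonempty α] (w : α → ℝ)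

theorem sum_toReal_proportional : ∑ a, (proportional w a).toReal = 1 := by
  rw [← ENNReal.toReal_sum fun a _ => PMF.apply_ne_top _ a, ← tsum_fintype (L := .unconditional α),
    PMF.tsum_coe, ENNReal.toReal_one]

theorem proportional_of_pos (hw : ∀ a, 0 ≤ w a) (hpos : 0 < ∑ a, w a) (a : α) :
    (proportional w a).toReal = w a / ∑ b, w b := by
  have hsum : ∑' a, ENNReal.ofReal (w a) = ENNReal.ofReal (∑ a, w a) := by
    rw [tsum_fintype, ENNReal.ofReal_sum_of_nonneg fun a _ => hw a]
  have h : (∑' a, ENNReal.ofReal (w a)) ≠ 0 := by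
    rw [hsum]
    exact (ENNReal.ofReal_pos.2 hpos).ne'
  rw [proportional, dif_pos h, PMF.normalize_apply, hsum, ENNReal.toReal_mul, ENNReal.toReal_inv,
    ENNReal.toReal_ofReal (hw a), ENNReal.toReal_ofReal hpos.le, div_eq_mul_inv]

/-- This holds even if all weights vanish, whatever the distribution is then. -/
theorem sum_mul_toReal_proportional (hw : ∀ a, 0 ≤ w a) (a : α) :
    (∑ b, w b) * (proportional w a).toReal = w a := by
  rcases (Finset.sum_nonneg fun b (_ : b ∈ Finset.univ) => hw b).eq_or_lt' with h | h
  · rw [h, zero_mul, (Finset.sum_eq_zero_iff_of_nonneg fun b _ => hw b).1 h a (Finset.mem_univ a)]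
  · rw [proportional_of_pos w hw h, mul_div_cancel₀ _ h.ne']

theorem proportional_zero : proportional (fun _ : α => 0) = PMF.uniformOfFintype α := by
  rw [proportional, dif_neg (by simp)]

theorem proportional_one : proportional (fun _ : α => 1) = PMF.uniformOfFintype α := by
  ext a
  rw [proportional, dif_pos (by simp), PMF.normalize_apply, PMF.uniformOfFintype_apply]
  simp

end Proportional

/-! ### The analysis of `k`-means++ with unsquared distances -/

section KMeansPP

variable {n : ℕ} (d : PseudoMetric (Fin n) ℝ)

theorem medianCost_nonneg (S : Finset (Fin n)) : 0 ≤ medianCost d S :=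
  Finset.sum_nonneg fun j _ => distTo_nonneg d S j

/-- A center that is uniform in a cluster `A` costs at most twice as much for `A` as any fixed
center. -/
theorem sum_sum_dist_le (A : Finset (Fin n)) (c : Fin n) :
    ∑ a ∈ A, ∑ x ∈ A, d x a ≤ 2 * A.card * ∑ x ∈ A, d x c := by
  calc ∑ a ∈ A, ∑ x ∈ A, d x a ≤ ∑ a ∈ A, ∑ x ∈ A, (d x c + d a c) :=
        Finset.sum_le_sum fun a _ => Finset.sum_le_sum fun x _ => by
          rw [d.symm a c]; exact d.triangle x c a
    _ = 2 * A.card * ∑ x ∈ A, d x c := by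
        simp only [Finset.sum_add_distrib, Finset.sum_const, nsmul_eq_mul, ← Finset.mul_sum]
        ring

/-- A center that is drawn in a cluster `A` proportionally to the distance from the open centers
costs, for `A`, at most four times as much as any fixed center. The factor `∑ a ∈ A, d(a, S)`
normalizes the probabilities. -/
theorem sum_distTo_mul_sum_distTo_insert_le {S : Finset (Fin n)} (hS : S.Nonempty)
    (A : Finset (Fin n)) (c : Fin n) :
    ∑ a ∈ A, distTo d S a * ∑ x ∈ A, distTo d (insert a S) x ≤
      4 * (∑ a ∈ A, distTo d S a) * ∑ x ∈ A, d x c := by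
  rcases A.eq_empty_or_nonempty with rfl | hA
  · simp
  have hcard : (0 : ℝ) < A.card := by exact_mod_cast hA.card_pos
  set F := ∑ a ∈ A, distTo d S a with hF
  have hF0 : 0 ≤ F := Finset.sum_nonneg fun a _ => distTo_nonneg d S a
  have h1 : ∀ a, A.card * distTo d S a ≤ ∑ x ∈ A, d x a + F := fun a => by
    rw [hF, ← Finset.sum_add_distrib, ← nsmul_eq_mul, ← Finset.sum_const]
    exact Finset.sum_le_sum fun x _ => by rw [d.symm x a]; exact distTo_triangle d hS a x
  have h2 : ∀ a, A.card * (distTo d S a * ∑ x ∈ A, distTo d (insert a S) x) ≤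
      2 * F * ∑ x ∈ A, d x a := fun a => by
    set N := ∑ x ∈ A, distTo d (insert a S) x
    set D := ∑ x ∈ A, d x a
    have hN0 : 0 ≤ N := Finset.sum_nonneg fun x _ => distTo_nonneg d _ x
    have hND : N ≤ D := Finset.sum_le_sum fun x _ => distTo_insert_le d S a x
    have hNF : N ≤ F := Finset.sum_le_sum fun x _ =>
      distTo_anti d hS (Finset.subset_insert a S) x
    have h := mul_le_mul_of_nonneg_right (h1 a) hN0
    have h3 := mul_le_mul_of_nonneg_left hNF (hN0.trans hND)
    have h4 := mul_le_mul_of_nonneg_left hND hF0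
    nlinarith
  refine le_of_mul_le_mul_left ?_ hcard
  calc A.card * ∑ a ∈ A, distTo d S a * ∑ x ∈ A, distTo d (insert a S) x
      ≤ 2 * F * ∑ a ∈ A, ∑ x ∈ A, d x a := by
        rw [Finset.mul_sum, Finset.mul_sum]
        exact Finset.sum_le_sum fun a _ => h2 a
    _ ≤ 2 * F * (2 * A.card * ∑ x ∈ A, d x c) :=
        mul_le_mul_of_nonneg_left (sum_sum_dist_le d A c) (by positivity)
    _ = A.card * (4 * F * ∑ x ∈ A, d x c) := by ring

variable {ι : Type} [DecidableEq ι] (π : Fin n → ι) (ctr : ι → Fin n)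

/-- The cluster with label `A` of the clustering `π`. -/
def cluster (A : ι) : Finset (Fin n) := Finset.univ.filter fun x => π x = A

/-- The part of the `k`-median cost of `S` that is caused by the cluster `A`. -/
def clusterCost (S : Finset (Fin n)) (A : ι) : ℝ := ∑ x ∈ cluster π A, distTo d S x

/-- The `1`-median cost of the cluster `A` with the center `ctr A`. -/
def refCost (A : ι) : ℝ := ∑ x ∈ cluster π A, d x (ctr A)

theorem sum_sum_cluster [Fintype ι] (f : Fin n → ℝ) : ∑ A, ∑ x ∈ cluster π A, f x = ∑ x, f x :=
  Finset.sum_fiberwise _ _ _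

theorem clusterCost_nonneg (S : Finset (Fin n)) (A : ι) : 0 ≤ clusterCost d π S A :=
  Finset.sum_nonneg fun x _ => distTo_nonneg d S x

theorem refCost_nonneg (A : ι) : 0 ≤ refCost d π ctr A :=
  Finset.sum_nonneg fun x _ => d.nonneg x _

theorem clusterCost_insert_le {S : Finset (Fin n)} (hS : S.Nonempty) (a : Fin n) (A : ι) :
    clusterCost d π (insert a S) A ≤ clusterCost d π S A :=
  Finset.sum_le_sum fun x _ => distTo_anti d hS (Finset.subset_insert a S) x

theorem sum_clusterCost [Fintype ι] (S : Finset (Fin n)) :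
    ∑ A, clusterCost d π S A = medianCost d S :=
  sum_sum_cluster π _

variable [Fintype ι]

/-- The bound on the expected cost after `t` more draws, when the clusters with labels in `U` are
considered as not yet covered: the covered clusters cost what they cost now, the uncovered ones
four times their reference cost, both up to a harmonic factor, and a `t / |U|` fraction of the
current cost of the uncovered clusters disappears. -/
def potential (t : ℕ) (U : Finset ι) (S : Finset (Fin n)) : ℝ :=
  (∑ A ∈ Uᶜ, clusterCost d π S A + 4 * ∑ A ∈ U, refCost d π ctr A) * (1 + (harmonic t : ℝ)) +
    ((U.card : ℝ) - t) / U.card * ∑ A ∈ U, clusterCost d π S A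

theorem harmonic_nonneg (t : ℕ) : (0 : ℝ) ≤ (harmonic t : ℝ) := by
  rw [harmonic]
  push_cast
  exact Finset.sum_nonneg fun i _ => by positivity

theorem potential_insert_le {t : ℕ} {U : Finset ι} (ht : t ≤ U.card) {S : Finset (Fin n)}
    (hS : S.Nonempty) (a : Fin n) :
    potential d π ctr t U (insert a S) ≤ potential d π ctr t U S := by
  have h1 : (0 : ℝ) ≤ ((U.card : ℝ) - t) / U.card :=
    div_nonneg (sub_nonneg.2 (by exact_mod_cast ht)) (Nat.cast_nonneg _)
  have h2 := harmonic_nonneg t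
  have h3 := clusterCost_insert_le d π hS a
  unfold potential
  gcongr <;> exact h3 _

/-- The change of the bound when a new center hits the uncovered cluster `A`, on average over the
new center in `A`. -/
theorem sum_mul_potential_erase_le {t : ℕ} {U : Finset ι} (ht : t + 1 ≤ U.card) {A : ι}
    (hA : A ∈ U) {S : Finset (Fin n)} (hS : S.Nonempty) :
    ∑ a ∈ cluster π A, distTo d S a * potential d π ctr t (U.erase A) (insert a S) ≤
      clusterCost d π S A *
        ((∑ B ∈ Uᶜ, clusterCost d π S B + 4 * ∑ B ∈ U, refCost d π ctr B) *
            (1 + (harmonic t : ℝ)) +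
          ((U.card : ℝ) - 1 - t) / (U.card - 1) *
            (∑ B ∈ U, clusterCost d π S B - clusterCost d π S A)) := by
  set c := ∑ B ∈ Uᶜ, clusterCost d π S B with hc
  set O := ∑ B ∈ U, refCost d π ctr B with hO
  set m := ∑ B ∈ U, clusterCost d π S B with hm
  set H := (1 + (harmonic t : ℝ)) with hH
  have hH0 : 0 ≤ H := add_nonneg zero_le_one (harmonic_nonneg t)
  set q := ((U.card : ℝ) - 1 - t) / (U.card - 1) with hq
  have hcard : ((U.erase A).card : ℝ) = U.card - 1 := by
    rw [Finset.card_erase_of_mem hA, Nat.cast_sub (by omega), Nat.cast_one]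
  have hq0 : 0 ≤ q := by
    have : ((t + 1 : ℕ) : ℝ) ≤ U.card := by exact_mod_cast ht
    push_cast at this
    exact div_nonneg (by linarith) (by linarith [Nat.cast_nonneg (α := ℝ) t])
  have hpot : ∀ a, potential d π ctr t (U.erase A) (insert a S) ≤
      (c + clusterCost d π (insert a S) A + 4 * (O - refCost d π ctr A)) * H +
        q * (m - clusterCost d π S A) := by
    intro a
    have h1 : ∑ B ∈ (U.erase A)ᶜ, clusterCost d π (insert a S) B ≤
        c + clusterCost d π (insert a S) A := by
      rw [Finset.compl_erase, Finset.sum_insert (by simpa using hA), add_comm]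
      exact add_le_add_left (Finset.sum_le_sum fun B _ => clusterCost_insert_le d π hS a B) _
    have h2 : ∑ B ∈ U.erase A, clusterCost d π (insert a S) B ≤ m - clusterCost d π S A := by
      rw [hm, ← Finset.add_sum_erase U _ hA, add_sub_cancel_left]
      exact Finset.sum_le_sum fun B _ => clusterCost_insert_le d π hS a B
    have h3 : ∑ B ∈ U.erase A, refCost d π ctr B = O - refCost d π ctr A := by
      rw [hO, ← Finset.add_sum_erase U _ hA, add_sub_cancel_left]
    unfold potential
    rw [hcard, h3]
    gcongr
  have hnew : ∑ a ∈ cluster π A, distTo d S a * clusterCost d π (insert a S) A ≤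
      4 * clusterCost d π S A * refCost d π ctr A :=
    sum_distTo_mul_sum_distTo_insert_le d hS _ _
  calc ∑ a ∈ cluster π A, distTo d S a * potential d π ctr t (U.erase A) (insert a S)
      ≤ ∑ a ∈ cluster π A, (H * (distTo d S a * clusterCost d π (insert a S) A) +
          distTo d S a * ((c + 4 * (O - refCost d π ctr A)) * H +
            q * (m - clusterCost d π S A))) := by
        refine Finset.sum_le_sum fun a _ => ?_
        have := mul_le_mul_of_nonneg_left (hpot a) (distTo_nonneg d S a)
        linarith
    _ = H * (∑ a ∈ cluster π A, distTo d S a * clusterCost d π (insert a S) A) +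
          clusterCost d π S A * ((c + 4 * (O - refCost d π ctr A)) * H +
            q * (m - clusterCost d π S A)) := by
        rw [Finset.sum_add_distrib, ← Finset.mul_sum, ← Finset.sum_mul]
        rfl
    _ ≤ H * (4 * clusterCost d π S A * refCost d π ctr A) +
          clusterCost d π S A * ((c + 4 * (O - refCost d π ctr A)) * H +
            q * (m - clusterCost d π S A)) := by gcongr
    _ = _ := by ring

/-- The combination of the two cases of a draw: `c`, `m` are the present costs of the covered and
the uncovered clusters, `O` is four times the reference cost of the uncovered ones, `Q` the sum of
the squares of the costs of the `u` uncovered clusters. -/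
theorem potential_arith {c m O H Q u t : ℝ} (hc : 0 ≤ c) (hm : 0 ≤ m) (hO : 0 ≤ O)
    (ht : 0 ≤ t) (htu : t + 1 ≤ u) (hQ : m ^ 2 ≤ u * Q) :
    c * ((c + O) * H + (u - t) / u * m) +
        (m * ((c + O) * H) + (u - 1 - t) / (u - 1) * (m ^ 2 - Q)) ≤
      (c + m) * ((c + O) * (H + (t + 1)⁻¹) + (u - (t + 1)) / u * m) := by
  have hu : 0 < u := by linarith
  have h1 : (u - 1 - t) / (u - 1) * (m ^ 2 - Q) ≤ (u - (t + 1)) / u * m ^ 2 := by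
    rcases (show 1 ≤ u by linarith).eq_or_lt' with h | h
    · have : t = 0 := by linarith
      subst this
      rw [h]
      simp
    · have h2 : m ^ 2 - Q ≤ (u - 1) / u * m ^ 2 := by
        have : m ^ 2 / u ≤ Q := by rw [div_le_iff₀ hu]; linarith
        have h3 : (u - 1) / u * m ^ 2 = m ^ 2 - m ^ 2 / u := by field_simp
        linarith
      calc (u - 1 - t) / (u - 1) * (m ^ 2 - Q)
          ≤ (u - 1 - t) / (u - 1) * ((u - 1) / u * m ^ 2) :=
            mul_le_mul_of_nonneg_left h2 (div_nonneg (by linarith) (by linarith))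
        _ = (u - (t + 1)) / u * m ^ 2 := by
            have : u - 1 ≠ 0 := by linarith
            field_simp
            ring
  have h2 : c * m * u⁻¹ ≤ (c + m) * (c + O) * (t + 1)⁻¹ := by
    have h3 : u⁻¹ ≤ (t + 1)⁻¹ := inv_anti₀ (by linarith) htu
    have h4 : c * m ≤ (c + m) * (c + O) := by nlinarith [mul_nonneg hc hO, mul_nonneg hm hO]
    exact mul_le_mul h4 h3 (by positivity) (by positivity)
  have h3 : c * ((u - t) / u * m) = c * ((u - (t + 1)) / u * m) + c * m * u⁻¹ := by
    field_simp
    ring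
  nlinarith

/-- The probability that `k`-means++ opens `j` next if the centers in `S` are open. -/
def nextProb [NeZero n] (S : Finset (Fin n)) (j : Fin n) : ℝ :=
  (proportional (distTo d S) j).toReal

/-- The expected `k`-median cost after `t` more steps of `k`-means++ from the centers in `S`. -/
def expCost [NeZero n] : ℕ → Finset (Fin n) → ℝ
  | 0, S => medianCost d S
  | t + 1, S => ∑ j, nextProb d S j * expCost t (insert j S)

variable [NeZero n]

theorem nextProb_nonneg (S : Finset (Fin n)) (j : Fin n) : 0 ≤ nextProb d S j :=
  ENNReal.toReal_nonneg

theorem sum_nextProb (S : Finset (Fin n)) : ∑ j, nextProb d S j = 1 :=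
  sum_toReal_proportional _

theorem medianCost_mul_nextProb (S : Finset (Fin n)) (j : Fin n) :
    medianCost d S * nextProb d S j = distTo d S j :=
  sum_mul_toReal_proportional _ (distTo_nonneg d S) j

theorem expCost_nonneg (t : ℕ) (S : Finset (Fin n)) : 0 ≤ expCost d t S := by
  induction t generalizing S with
  | zero => exact medianCost_nonneg d S
  | succ t ih => exact Finset.sum_nonneg fun j _ => mul_nonneg (nextProb_nonneg d S j) (ih _)

theorem expCost_le_medianCost (t : ℕ) {S : Finset (Fin n)} (hS : S.Nonempty) :
    expCost d t S ≤ medianCost d S := by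
  induction t generalizing S with
  | zero => exact le_rfl
  | succ t ih =>
    calc expCost d (t + 1) S ≤ ∑ j, nextProb d S j * medianCost d S := by
          refine Finset.sum_le_sum fun j _ =>
            mul_le_mul_of_nonneg_left ?_ (nextProb_nonneg d S j)
          exact (ih (Finset.insert_nonempty j S)).trans
            (Finset.sum_le_sum fun x _ => distTo_anti d hS (Finset.subset_insert j S) x)
      _ = medianCost d S := by rw [← Finset.sum_mul, sum_nextProb, one_mul]

theorem medianCost_mul_expCost_succ (t : ℕ) (S : Finset (Fin n)) :
    medianCost d S * expCost d (t + 1) S = ∑ j, distTo d S j * expCost d t (insert j S) := by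
  rw [expCost, Finset.mul_sum]
  exact Finset.sum_congr rfl fun j _ => by rw [← mul_assoc, medianCost_mul_nextProb]

/-- The central induction of the analysis of `k`-means++. -/
theorem expCost_le_potential (t : ℕ) (U : Finset ι) (ht : t ≤ U.card) {S : Finset (Fin n)}
    (hS : S.Nonempty) : expCost d t S ≤ potential d π ctr t U S := by
  induction t generalizing U S with
  | zero =>
    have h1 : ((U.card : ℝ) - (0 : ℕ)) / U.card * ∑ A ∈ U, clusterCost d π S A =
        ∑ A ∈ U, clusterCost d π S A := by
      rcases U.eq_empty_or_nonempty with rfl | h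
      · simp
      · have : (U.card : ℝ) ≠ 0 := by exact_mod_cast h.card_pos.ne'
        rw [Nat.cast_zero, sub_zero, div_self this, one_mul]
    have h2 : 0 ≤ ∑ A ∈ U, refCost d π ctr A :=
      Finset.sum_nonneg fun A _ => refCost_nonneg d π ctr A
    rw [potential, h1, expCost, ← sum_clusterCost d π S, ← Finset.sum_compl_add_sum U]
    simp only [harmonic_zero, Rat.cast_zero, add_zero, mul_one]
    linarith
  | succ t ih =>
    set c := ∑ B ∈ Uᶜ, clusterCost d π S B with hc
    set O := ∑ B ∈ U, refCost d π ctr B with hO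
    set m := ∑ B ∈ U, clusterCost d π S B with hm
    set H := (1 + (harmonic t : ℝ)) with hH
    have hc0 : 0 ≤ c := Finset.sum_nonneg fun A _ => clusterCost_nonneg d π S A
    have hm0 : 0 ≤ m := Finset.sum_nonneg fun A _ => clusterCost_nonneg d π S A
    have hO0 : 0 ≤ O := Finset.sum_nonneg fun A _ => refCost_nonneg d π ctr A
    have hcm : medianCost d S = c + m := by
      rw [← sum_clusterCost d π S, ← Finset.sum_compl_add_sum U]
    have htu : ((t : ℝ) + 1) ≤ U.card := by exact_mod_cast ht
    have hpot : potential d π ctr (t + 1) U S =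
        (c + 4 * O) * (H + ((t : ℝ) + 1)⁻¹) + ((U.card : ℝ) - (t + 1)) / U.card * m := by
      rw [potential, harmonic_succ]
      push_cast
      ring
    rcases (medianCost_nonneg d S).eq_or_lt' with h0 | hpos
    · refine ((expCost_le_medianCost d (t + 1) hS).trans_eq h0).trans ?_
      have hH0 : 0 ≤ H := add_nonneg zero_le_one (harmonic_nonneg t)
      rw [hpot]
      exact add_nonneg (by positivity)
        (mul_nonneg (div_nonneg (by linarith) (Nat.cast_nonneg _)) hm0)
    · refine le_of_mul_le_mul_left ?_ hpos
      have hcov : ∑ A ∈ Uᶜ, ∑ a ∈ cluster π A, distTo d S a * expCost d t (insert a S) ≤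
          c * ((c + 4 * O) * H + ((U.card : ℝ) - t) / U.card * m) := by
        rw [hc, Finset.sum_mul]
        refine Finset.sum_le_sum fun A _ => ?_
        rw [clusterCost, Finset.sum_mul]
        exact Finset.sum_le_sum fun a _ => mul_le_mul_of_nonneg_left
          ((ih U (by omega) (Finset.insert_nonempty a S)).trans
            (potential_insert_le d π ctr (by omega) hS a)) (distTo_nonneg d S a)
      have hunc : ∑ A ∈ U, ∑ a ∈ cluster π A, distTo d S a * expCost d t (insert a S) ≤
          m * ((c + 4 * O) * H) + ((U.card : ℝ) - 1 - t) / (U.card - 1) *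
            (m ^ 2 - ∑ A ∈ U, clusterCost d π S A ^ 2) := by
        calc ∑ A ∈ U, ∑ a ∈ cluster π A, distTo d S a * expCost d t (insert a S)
            ≤ ∑ A ∈ U, clusterCost d π S A * ((c + 4 * O) * H +
                ((U.card : ℝ) - 1 - t) / (U.card - 1) * (m - clusterCost d π S A)) := by
              refine Finset.sum_le_sum fun A hA => ?_
              refine le_trans (Finset.sum_le_sum fun a _ => mul_le_mul_of_nonneg_left
                (ih (U.erase A) ?_ (Finset.insert_nonempty a S)) (distTo_nonneg d S a))
                (sum_mul_potential_erase_le d π ctr ht hA hS)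
              rw [Finset.card_erase_of_mem hA]
              omega
          _ = ∑ A ∈ U, (clusterCost d π S A * ((c + 4 * O) * H +
                ((U.card : ℝ) - 1 - t) / (U.card - 1) * m) -
                ((U.card : ℝ) - 1 - t) / (U.card - 1) * clusterCost d π S A ^ 2) :=
              Finset.sum_congr rfl fun A _ => by ring
          _ = _ := by
              rw [Finset.sum_sub_distrib, ← Finset.sum_mul, ← Finset.mul_sum]
              ring
      have hQ : m ^ 2 ≤ U.card * ∑ A ∈ U, clusterCost d π S A ^ 2 := sq_sum_le_card_mul_sum_sq
      rw [medianCost_mul_expCost_succ, ← sum_sum_cluster π, ← Finset.sum_compl_add_sum U, hpot,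
        hcm]
      exact (add_le_add hcov hunc).trans
        (potential_arith hc0 hm0 (by positivity) (Nat.cast_nonneg t) htu hQ)

/-- The expected cost of `k`-means++ with `|ι|` centers, the first of them uniform. -/
theorem sum_expCost_singleton_le {t : ℕ} (ht : Fintype.card ι = t + 1) :
    ∑ a, expCost d t {a} ≤
      n * (4 * (1 + (harmonic t : ℝ)) * ∑ x, d x (ctr (π x))) := by
  set H := (1 + (harmonic t : ℝ)) with hH
  have hH0 : 0 ≤ H := add_nonneg zero_le_one (harmonic_nonneg t)
  set O := ∑ A, refCost d π ctr A with hO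
  have hOe : O = ∑ x, d x (ctr (π x)) := by
    rw [hO, ← sum_sum_cluster π]
    refine Finset.sum_congr rfl fun A _ => Finset.sum_congr rfl fun x hx => ?_
    rw [(Finset.mem_filter.1 hx).2]
  have h1 : ∀ a, expCost d t {a} ≤
      (∑ x ∈ cluster π (π a), d x a + 4 * (O - refCost d π ctr (π a))) * H := fun a => by
    have hcard : (Finset.univ.erase (π a)).card = t := by
      rw [Finset.card_erase_of_mem (Finset.mem_univ _), Finset.card_univ, ht]
      rfl
    have h := expCost_le_potential d π ctr t (Finset.univ.erase (π a)) hcard.ge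
      (Finset.singleton_nonempty a)
    have hO' : ∑ B ∈ Finset.univ.erase (π a), refCost d π ctr B = O - refCost d π ctr (π a) := by
      rw [hO, ← Finset.add_sum_erase _ _ (Finset.mem_univ (π a)), add_sub_cancel_left]
    rw [potential, hcard, sub_self, zero_div, zero_mul, add_zero, Finset.compl_erase,
      Finset.compl_univ, insert_empty_eq, Finset.sum_singleton, hO'] at h
    refine h.trans ?_
    gcongr
    exact Finset.sum_le_sum fun x _ => distTo_le d (Finset.mem_singleton_self a) x
  have h2 : ∀ A, ∑ a ∈ cluster π A, (∑ x ∈ cluster π A, d x a + 4 * (O - refCost d π ctr A)) ≤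
      ∑ a ∈ cluster π A, 4 * O := fun A => by
    have h := sum_sum_dist_le d (cluster π A) (ctr A)
    have h0 := mul_nonneg (Nat.cast_nonneg (α := ℝ) (cluster π A).card) (refCost_nonneg d π ctr A)
    rw [← refCost] at h
    rw [Finset.sum_add_distrib]
    simp only [Finset.sum_const, nsmul_eq_mul]
    nlinarith
  calc ∑ a, expCost d t {a}
      ≤ ∑ a, (∑ x ∈ cluster π (π a), d x a + 4 * (O - refCost d π ctr (π a))) * H :=
        Finset.sum_le_sum fun a _ => h1 a
    _ = (∑ A, ∑ a ∈ cluster π A,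
          (∑ x ∈ cluster π A, d x a + 4 * (O - refCost d π ctr A))) * H := by
        rw [← Finset.sum_mul, ← sum_sum_cluster π]
        congr 1
        refine Finset.sum_congr rfl fun A _ => Finset.sum_congr rfl fun a ha => ?_
        rw [(Finset.mem_filter.1 ha).2]
    _ ≤ (∑ A, ∑ a ∈ cluster π A, 4 * O) * H :=
        mul_le_mul_of_nonneg_right (Finset.sum_le_sum fun A _ => h2 A) hH0
    _ = _ := by
        rw [sum_sum_cluster π, hOe]
        simp only [Finset.sum_const, Finset.card_univ, Fintype.card_fin, nsmul_eq_mul]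
        ring

/-- The expected cost of `k`-means++ is within a factor `4 (ln k + 2)` of the cost of every set of
at most `k = t + 1` centers. Such a set gives a clustering with `k` labels, some clusters of which
may be empty. -/
theorem sum_expCost_singleton_le_medianCost {t : ℕ} {S : Finset (Fin n)} (hS : S.Nonempty)
    (hcard : S.card ≤ t + 1) :
    ∑ a, expCost d t {a} ≤
      n * (4 * (Real.log ((t + 1 : ℕ) : ℝ) + 2) * medianCost d S) := by
  obtain ⟨e⟩ := Function.Embedding.nonempty_of_card_le (α := S) (β := Fin (t + 1))
    (by simpa using hcard)
  have : Nonempty S := hS.to_subtype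
  choose f hfS hf using exists_distTo_eq d hS
  have h := sum_expCost_singleton_le d (fun x => e ⟨f x, hfS x⟩)
    (fun i => (Function.invFun e i).1) (Fintype.card_fin (t + 1))
  have he : ∑ x, d x (Function.invFun e (e ⟨f x, hfS x⟩)).1 = medianCost d S :=
    Finset.sum_congr rfl fun x _ => by
      rw [Function.leftInverse_invFun e.injective, hf]
  rw [he] at h
  refine h.trans ?_
  have hlog : 1 + (harmonic t : ℝ) ≤ Real.log ((t + 1 : ℕ) : ℝ) + 2 := by
    rcases Nat.eq_zero_or_pos t with rfl | htpos
    · simp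
    · have h1 := harmonic_le_one_add_log t
      have h2 : Real.log t ≤ Real.log ((t + 1 : ℕ) : ℝ) :=
        Real.log_le_log (by exact_mod_cast htpos) (by exact_mod_cast Nat.le_succ t)
      linarith
  have := medianCost_nonneg d S
  gcongr

end KMeansPP

/-! ### The success probability of `k`-means++ -/

section Markov

variable {α β : Type}

/-- The expectation of a nonnegative function. -/
def expect (p : PMF α) (f : α → ℝ≥0∞) : ℝ≥0∞ := ∑' a, p a * f a

theorem expect_bind (p : PMF α) (q : α → PMF β) (f : β → ℝ≥0∞) :
    expect (p.bind q) f = expect p fun a => expect (q a) f := by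
  simp only [expect, PMF.bind_apply, ← ENNReal.tsum_mul_right, ← ENNReal.tsum_mul_left]
  rw [ENNReal.tsum_comm]
  simp only [mul_assoc]

theorem expect_pure (a : α) (f : α → ℝ≥0∞) : expect (PMF.pure a) f = f a := by
  rw [expect, tsum_eq_single a fun b hb => by rw [PMF.pure_apply_of_ne a b hb, zero_mul],
    PMF.pure_apply_self, one_mul]

theorem expect_map (p : PMF α) (g : α → β) (f : β → ℝ≥0∞) :
    expect (p.map g) f = expect p fun a => f (g a) := by
  simp only [PMF.map, expect_bind, Function.comp_apply, expect_pure]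

theorem expect_congr {p : PMF α} {f g : α → ℝ≥0∞} (h : ∀ a ∈ p.support, f a = g a) :
    expect p f = expect p g := by
  refine tsum_congr fun a => ?_
  by_cases ha : p a = 0
  · rw [ha, zero_mul, zero_mul]
  · rw [h a ((p.mem_support_iff a).2 ha)]

theorem half_le_toOuterMeasure_of_expect_le (p : PMF α) (f : α → ℝ) {r : ℝ} (hr : 0 ≤ r)
    (h : expect p (fun a => ENNReal.ofReal (f a)) ≤ ENNReal.ofReal r) :
    (1 / 2 : ℝ≥0∞) ≤ p.toOuterMeasure {a | f a ≤ 2 * r} := by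
  set G := {a | f a ≤ 2 * r} with hG
  have hsum : p.toOuterMeasure G + p.toOuterMeasure Gᶜ = 1 := by
    rw [PMF.toOuterMeasure_apply, PMF.toOuterMeasure_apply, ← ENNReal.tsum_add, ← p.tsum_coe]
    refine tsum_congr fun a => ?_
    rw [← Pi.add_apply, Set.indicator_self_add_compl]
  have hbad : p.toOuterMeasure Gᶜ ≤ 1 / 2 := by
    rcases hr.eq_or_lt with h0 | hpos
    · rw [← h0, ENNReal.ofReal_zero, nonpos_iff_eq_zero, expect, ENNReal.tsum_eq_zero] at h
      rw [PMF.toOuterMeasure_apply, ENNReal.tsum_eq_zero.2 fun a => ?_]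
      · exact bot_le
      rw [Set.indicator_apply_eq_zero]
      intro ha
      refine (mul_eq_zero.1 (h a)).resolve_right (ENNReal.ofReal_pos.2 ?_).ne'
      simpa [hG, ← h0] using ha
    · have h1 : p.toOuterMeasure Gᶜ * (2 * ENNReal.ofReal r) ≤ ENNReal.ofReal r := by
        refine le_trans ?_ h
        rw [PMF.toOuterMeasure_apply, ← ENNReal.tsum_mul_right]
        refine ENNReal.tsum_le_tsum fun a => ?_
        by_cases ha : a ∈ Gᶜ
        · rw [Set.indicator_of_mem ha]
          refine mul_le_mul_right ?_ _
          rw [← ENNReal.ofReal_ofNat 2, ← ENNReal.ofReal_mul zero_le_two]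
          have ha' : ¬ f a ≤ 2 * r := ha
          exact ENNReal.ofReal_le_ofReal (not_le.1 ha').le
        · rw [Set.indicator_of_notMem ha, zero_mul]
          exact bot_le
      have hne : ENNReal.ofReal r ≠ 0 := (ENNReal.ofReal_pos.2 hpos).ne'
      rw [← mul_assoc] at h1
      have h2 : p.toOuterMeasure Gᶜ * 2 ≤ 1 :=
        (ENNReal.mul_le_mul_iff_left hne ENNReal.ofReal_ne_top).1 (by rwa [one_mul])
      rwa [ENNReal.le_div_iff_mul_le (Or.inl two_ne_zero) (Or.inl ENNReal.ofNat_ne_top)]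
  by_contra hlt
  rw [not_le] at hlt
  have h1 := ENNReal.add_lt_add_of_lt_of_le (ne_top_of_le_ne_top (by simp) hbad) hlt hbad
  rw [hsum, one_div, ENNReal.inv_two_add_inv_two] at h1
  exact lt_irrefl _ h1

end Markov

section Law

variable {n : ℕ} [NeZero n] (d : PseudoMetric (Fin n) ℝ)

theorem length_of_mem_support_kMeansPPLaw {t : ℕ} {s : List (Fin n)}
    (hs : s ∈ (kMeansPPLaw d t).support) : s.length = t := by
  induction t generalizing s with
  | zero =>
    rw [kMeansPPLaw, PMF.mem_support_pure_iff] at hs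
    rw [hs]
    rfl
  | succ t ih =>
    rw [kMeansPPLaw, PMF.mem_support_bind_iff] at hs
    obtain ⟨s', hs', hs⟩ := hs
    obtain ⟨j, -, rfl⟩ := (PMF.mem_support_map_iff _ _ _).1 hs
    rw [List.length_append, ih hs', List.length_singleton]

theorem expect_proportional (w : Fin n → ℝ) {f : Fin n → ℝ} (hf : ∀ j, 0 ≤ f j) :
    expect (proportional w) (fun j => ENNReal.ofReal (f j)) =
      ENNReal.ofReal (∑ j, (proportional w j).toReal * f j) := by
  rw [expect, tsum_fintype, ENNReal.ofReal_sum_of_nonneg fun j _ =>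
    mul_nonneg ENNReal.toReal_nonneg (hf j)]
  refine Finset.sum_congr rfl fun j _ => ?_
  rw [ENNReal.ofReal_mul ENNReal.toReal_nonneg, ENNReal.ofReal_toReal (PMF.apply_ne_top _ _)]

theorem expect_expCost_succ {m : ℕ} (hm : m ≠ 0) (t : ℕ) :
    expect (kMeansPPLaw d (m + 1)) (fun s => ENNReal.ofReal (expCost d t s.toFinset)) =
      expect (kMeansPPLaw d m) (fun s => ENNReal.ofReal (expCost d (t + 1) s.toFinset)) := by
  rw [kMeansPPLaw, expect_bind]
  refine expect_congr fun s hs => ?_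
  have hne : s ≠ [] := by
    rintro rfl
    exact hm (length_of_mem_support_kMeansPPLaw d hs).symm
  rw [expect_map, if_neg hne, expect_proportional _ fun j => expCost_nonneg d t _]
  simp only [List.toFinset_append, List.toFinset_cons, List.toFinset_nil, expCost, nextProb]
  congr 1
  refine Finset.sum_congr rfl fun j _ => ?_
  rw [insert_empty_eq, Finset.union_singleton]

theorem expect_medianCost (t : ℕ) :
    expect (kMeansPPLaw d (t + 1)) (fun s => ENNReal.ofReal (medianCost d s.toFinset)) =
      ENNReal.ofReal ((n : ℝ)⁻¹ * ∑ a, expCost d t {a}) := by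
  have h : ∀ m r, expect (kMeansPPLaw d (m + 1 + r))
      (fun s => ENNReal.ofReal (medianCost d s.toFinset)) =
      expect (kMeansPPLaw d (m + 1)) (fun s => ENNReal.ofReal (expCost d r s.toFinset)) := by
    intro m r
    induction r generalizing m with
    | zero => rfl
    | succ r ih =>
      rw [← expect_expCost_succ d m.succ_ne_zero, ← ih, Nat.add_right_comm (m + 1) 1 r]
      rfl
  have h1 := h 0 t
  rw [Nat.zero_add, Nat.add_comm] at h1
  rw [h1]
  simp only [kMeansPPLaw, PMF.pure_bind, if_true, List.nil_append]
  rw [expect_map, expect_proportional _ fun j => expCost_nonneg d t _, proportional_one,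
    Finset.mul_sum]
  congr 1
  refine Finset.sum_congr rfl fun j _ => ?_
  rw [PMF.uniformOfFintype_apply]
  simp

/-- The guarantee for `k`-means++: the lower bound holds surely, the upper bound by Markov's
inequality. -/
theorem half_le_kMeansPPLaw {k l : ℕ} (hk : 1 ≤ k) (hl : 1 ≤ l) (hln : l ≤ n) :
    (1 / 2 : ℝ≥0∞) ≤ (kMeansPPLaw d k).toOuterMeasure
      {s | opt d k l ≤ medianCost d s.toFinset ∧
        medianCost d s.toFinset ≤
          8 * (Real.log (k : ℝ) + 2) * ((n : ℝ) / (l : ℝ)) * opt d k l} := by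
  obtain ⟨t, rfl⟩ : ∃ t, k = t + 1 := ⟨k - 1, by omega⟩
  have hl0 : (0 : ℝ) < l := by exact_mod_cast hl
  have hn0 : (0 : ℝ) < n := hl0.trans_le (by exact_mod_cast hln)
  have hlog : 0 < Real.log ((t + 1 : ℕ) : ℝ) + 2 :=
    add_pos_of_nonneg_of_pos (Real.log_natCast_nonneg _) two_pos
  set r := 4 * (Real.log ((t + 1 : ℕ) : ℝ) + 2) * ((n : ℝ) / (l : ℝ)) with hr
  have hr0 : 0 < r := by positivity
  have hb : (n : ℝ)⁻¹ * ∑ a, expCost d t {a} ≤ r * opt d (t + 1) l := by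
    refine le_mul_opt d hk hr0 fun S hS hSk => ?_
    have h1 := sum_expCost_singleton_le_medianCost d hS hSk
    have h2 : medianCost d S ≤ (n : ℝ) / l * topCost l (distTo d S) := by
      rw [div_mul_eq_mul_div, le_div_iff₀' hl0]
      exact mul_sum_le_mul_topCost _ hl hln
    rw [inv_mul_le_iff₀ hn0, hr]
    refine h1.trans ?_
    rw [mul_assoc _ ((n : ℝ) / l)]
    gcongr
  have hb0 : 0 ≤ (n : ℝ)⁻¹ * ∑ a, expCost d t {a} :=
    mul_nonneg (inv_nonneg.2 hn0.le) (Finset.sum_nonneg fun a _ => expCost_nonneg d t _)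
  have h := half_le_toOuterMeasure_of_expect_le (kMeansPPLaw d (t + 1))
    (fun s => medianCost d s.toFinset) (hb0.trans hb)
    ((expect_medianCost d t).trans_le (ENNReal.ofReal_le_ofReal hb))
  refine h.trans (PMF.toOuterMeasure_mono _ ?_)
  rintro s ⟨hs, hsupp⟩
  have hlen := length_of_mem_support_kMeansPPLaw d hsupp
  have hne : s.toFinset.Nonempty := by
    rw [List.toFinset_nonempty_iff]
    rintro rfl
    simp at hlen
  refine ⟨(opt_le d hne (hlen ▸ List.toFinset_card_le s) l).trans
    (topCost_le_sum (distTo_nonneg d _) l), ?_⟩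
  refine (show medianCost d s.toFinset ≤ _ from hs).trans_eq ?_
  rw [hr]
  ring

end Law

/-! ### Couplings -/

section Coupling

variable {α β α' β' γ : Type}

/-- The distributions `p` and `q` have a coupling that is supported on the relation `R`. -/
def Coupled (p : PMF α) (q : PMF β) (R : α → β → Prop) : Prop :=
  ∃ P : PMF (α × β), P.map Prod.fst = p ∧ P.map Prod.snd = q ∧ ∀ x ∈ P.support, R x.1 x.2

theorem Coupled.pure {a : α} {b : β} {R : α → β → Prop} (h : R a b) :
    Coupled (PMF.pure a) (PMF.pure b) R := by
  refine ⟨PMF.pure (a, b), PMF.pure_map _ _, PMF.pure_map _ _, fun x hx => ?_⟩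
  rw [PMF.mem_support_pure_iff] at hx
  rwa [hx]

theorem Coupled.refl (p : PMF α) : Coupled p p Eq := by
  refine ⟨p.map fun a => (a, a), ?_, ?_, fun x hx => ?_⟩
  · rw [PMF.map_comp]
    exact PMF.map_id p
  · rw [PMF.map_comp]
    exact PMF.map_id p
  · obtain ⟨a, -, rfl⟩ := (PMF.mem_support_map_iff _ _ _).1 hx
    rfl

theorem Coupled.bind {p : PMF α} {q : PMF β} {R : α → β → Prop} (h : Coupled p q R)
    {f : α → PMF α'} {g : β → PMF β'} {R' : α' → β' → Prop}
    (hfg : ∀ a b, R a b → Coupled (f a) (g b) R') : Coupled (p.bind f) (q.bind g) R' := by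
  obtain ⟨P, rfl, rfl, hP⟩ := h
  have hK : ∀ x : α × β, ∃ K : PMF (α' × β'), K.map Prod.fst = f x.1 ∧ K.map Prod.snd = g x.2 ∧
      (R x.1 x.2 → ∀ y ∈ K.support, R' y.1 y.2) := by
    intro x
    by_cases hx : R x.1 x.2
    · obtain ⟨K, h1, h2, h3⟩ := hfg _ _ hx
      exact ⟨K, h1, h2, fun _ => h3⟩
    · -- off the relation, the product coupling has the right marginals
      refine ⟨(f x.1).bind fun a => (g x.2).map fun b => (a, b), ?_, ?_, fun h => absurd h hx⟩
      · simp only [PMF.map_bind, PMF.map_comp]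
        exact (congrArg _ (funext fun a => PMF.map_const _ a)).trans (PMF.bind_pure _)
      · simp only [PMF.map_bind, PMF.map_comp]
        exact (congrArg _ (funext fun a => PMF.map_id _)).trans (PMF.bind_const _ _)
  choose K h1 h2 h3 using hK
  refine ⟨P.bind K, ?_, ?_, fun y hy => ?_⟩
  · rw [PMF.map_bind, PMF.bind_map]
    exact congrArg _ (funext h1)
  · rw [PMF.map_bind, PMF.bind_map]
    exact congrArg _ (funext h2)
  · obtain ⟨x, hx, hy⟩ := (PMF.mem_support_bind_iff _ _ _).1 hy
    exact h3 x (hP x hx) y hy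

theorem Coupled.map_eq {p : PMF α} {q : PMF β} {R : α → β → Prop} (h : Coupled p q R)
    {u : α → γ} {v : β → γ} (huv : ∀ a b, R a b → u a = v b) : p.map u = q.map v := by
  obtain ⟨P, rfl, rfl, hP⟩ := h
  rw [PMF.map_comp, PMF.map_comp]
  ext c
  rw [PMF.map_apply, PMF.map_apply]
  refine tsum_congr fun x => ?_
  by_cases hx : P x = 0
  · simp [hx]
  · rw [Function.comp_apply, Function.comp_apply, huv _ _ (hP x ((P.mem_support_iff x).2 hx))]

theorem Coupled.exists_of_mem_support {p : PMF α} {q : PMF β} {R : α → β → Prop}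
    (h : Coupled p q R) {b : β} (hb : b ∈ q.support) : ∃ a ∈ p.support, R a b := by
  obtain ⟨P, rfl, rfl, hP⟩ := h
  obtain ⟨x, hx, rfl⟩ := (PMF.mem_support_map_iff _ _ _).1 hb
  exact ⟨x.1, (PMF.mem_support_map_iff _ _ _).2 ⟨x, hx, rfl⟩, hP x hx⟩

end Coupling

/-! ### Program logic for deterministic runs -/

section Runs

variable {n : ℕ} {σ : Profile n} {d : PseudoMetric (Fin n) ℝ} {c : Config n} {Q : Config n → Prop}

/-- Started in `c`, the program `p` ends surely in one configuration, which satisfies `Q`. -/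
def Runs (σ : Profile n) (d : PseudoMetric (Fin n) ℝ) (p : Prog) (c : Config n)
    (Q : Config n → Prop) : Prop :=
  ∃ c', p.exec σ d c = PMF.pure c' ∧ Q c'

theorem Runs.skip (h : Q (c.tick 1)) : Runs σ d .skip c Q := ⟨_, rfl, h⟩

theorem Runs.setNat {a : ℕ} {idx e : NatExpr}
    (h : Q ((c.setNat a (idx.eval σ c) (e.eval σ c)).tick 1)) : Runs σ d (.setNat a idx e) c Q :=
  ⟨_, rfl, h⟩

theorem Runs.setReal {a : ℕ} {idx : NatExpr} {e : RealExpr}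
    (h : Q ((c.setReal a (idx.eval σ c) (e.eval σ c)).tick 1)) :
    Runs σ d (.setReal a idx e) c Q :=
  ⟨_, rfl, h⟩

theorem Runs.query {a : ℕ} {idx i b : NatExpr}
    (h : Q ((c.ask d a (idx.eval σ c) (i.eval σ c) (b.eval σ c)).tick 1)) :
    Runs σ d (.query a idx i b) c Q :=
  ⟨_, rfl, h⟩

theorem Runs.seq {p q : Prog} (h : Runs σ d p c fun c' => Runs σ d q c' Q) :
    Runs σ d (.seq p q) c Q := by
  obtain ⟨c₁, h₁, c₂, h₂, hQ⟩ := h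
  exact ⟨c₂, by rw [Prog.exec, h₁, PMF.pure_bind, h₂], hQ⟩

theorem Runs.ite {b : BoolExpr} {p q : Prog} (hp : b.eval σ c → Runs σ d p (c.tick 1) Q)
    (hq : ¬ b.eval σ c → Runs σ d q (c.tick 1) Q) : Runs σ d (.ite b p q) c Q := by
  by_cases h : b.eval σ c
  · obtain ⟨c', h', hQ⟩ := hp h
    exact ⟨c', by rw [Prog.exec, if_pos h, h'], hQ⟩
  · obtain ⟨c', h', hQ⟩ := hq h
    exact ⟨c', by rw [Prog.exec, if_neg h, h'], hQ⟩

theorem Runs.mono {p : Prog} {Q' : Config n → Prop} (h : Runs σ d p c Q) (hQ : ∀ c', Q c' → Q' c') :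
    Runs σ d p c Q' := by
  obtain ⟨c', h', h⟩ := h
  exact ⟨c', h', hQ c' h⟩

/-- The distribution after the first `m` rounds of a loop. -/
def loopPMF (σ : Profile n) (d : PseudoMetric (Fin n) ℝ) (x : ℕ) (p : Prog) (c : Config n) :
    ℕ → PMF (Config n)
  | 0 => PMF.pure (c.tick 1)
  | m + 1 => (loopPMF σ d x p c m).bind fun c' => p.exec σ d ((c'.setNat x 0 m).tick 1)

theorem exec_forLoop (x : ℕ) (e : NatExpr) (p : Prog) :
    (Prog.forLoop x e p).exec σ d c = loopPMF σ d x p c (e.eval σ c) := by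
  rw [Prog.exec]
  generalize e.eval σ c = m
  induction m with
  | zero => rfl
  | succ m ih =>
    rw [List.range_succ, List.foldlM_append, ih, loopPMF]
    simp only [List.foldlM_cons, List.foldlM_nil, bind_pure]
    rfl

theorem Runs.forLoop {x : ℕ} {e : NatExpr} {p : Prog} (Inv : ℕ → Config n → Prop)
    (h0 : Inv 0 (c.tick 1))
    (hstep : ∀ t < e.eval σ c, ∀ c', Inv t c' →
      Runs σ d p ((c'.setNat x 0 t).tick 1) (Inv (t + 1)))
    (hQ : ∀ c', Inv (e.eval σ c) c' → Q c') : Runs σ d (.forLoop x e p) c Q := by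
  have h : ∀ m ≤ e.eval σ c, ∃ c', loopPMF σ d x p c m = PMF.pure c' ∧ Inv m c' := by
    intro m hm
    induction m with
    | zero => exact ⟨_, rfl, h0⟩
    | succ m ih =>
      obtain ⟨c₁, h₁, hI⟩ := ih (by omega)
      obtain ⟨c₂, h₂, hI₂⟩ := hstep m hm c₁ hI
      exact ⟨c₂, by rw [loopPMF, h₁, PMF.pure_bind, h₂], hI₂⟩
  obtain ⟨c', h', hI⟩ := h _ le_rfl
  exact ⟨c', by rw [exec_forLoop, h'], hQ c' hI⟩

end Runs

/-! ### Memory access and assignment of agents to centers -/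

namespace Config

variable {n : ℕ} (c : Config n) (a i v : ℕ) (x : ℝ)

@[simp] theorem nat_tick (m : ℕ) : (c.tick m).nat = c.nat := rfl
@[simp] theorem real_tick (m : ℕ) : (c.tick m).real = c.real := rfl
@[simp] theorem log_tick (m : ℕ) : (c.tick m).log = c.log := rfl
@[simp] theorem steps_tick (m : ℕ) : (c.tick m).steps = c.steps + m := rfl
@[simp] theorem real_setNat : (c.setNat a i v).real = c.real := rfl
@[simp] theorem log_setNat : (c.setNat a i v).log = c.log := rfl
@[simp] theorem steps_setNat : (c.setNat a i v).steps = c.steps := rfl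
@[simp] theorem nat_setReal : (c.setReal a i x).nat = c.nat := rfl
@[simp] theorem log_setReal : (c.setReal a i x).log = c.log := rfl
@[simp] theorem steps_setReal : (c.setReal a i x).steps = c.steps := rfl

@[simp] theorem nat_setNat_self : (c.setNat a i v).nat a i = v := if_pos ⟨rfl, rfl⟩

@[simp] theorem real_setReal_self : (c.setReal a i x).real a i = x := if_pos ⟨rfl, rfl⟩

variable {a i}

@[simp] theorem nat_setNat_array {a' : ℕ} (h : a' ≠ a) : (c.setNat a i v).nat a' = c.nat a' :=
  funext fun _ => if_neg fun h' => h h'.1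

theorem nat_setNat_index {i' : ℕ} (h : i' ≠ i) : (c.setNat a i v).nat a i' = c.nat a i' :=
  if_neg fun h' => h h'.2

@[simp] theorem real_setReal_array {a' : ℕ} (h : a' ≠ a) :
    (c.setReal a i x).real a' = c.real a' :=
  funext fun _ => if_neg fun h' => h h'.1

theorem real_setReal_index {i' : ℕ} (h : i' ≠ i) :
    (c.setReal a i x).real a i' = c.real a i' :=
  if_neg fun h' => h h'.2

theorem ask_of_fin (d : PseudoMetric (Fin n) ℝ) (b idx : ℕ) (j y : Fin n) :
    c.ask d b idx j y = { c.setReal b idx (d j y) with log := (j, y) :: c.log } :=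
  dif_pos ⟨j.2, y.2⟩

end Config

section Assign

variable {n : ℕ} {σ : Profile n} {d : PseudoMetric (Fin n) ℝ} {c : Config n}

theorem NatExpr.eval_rank {e₁ e₂ : NatExpr} {j a : Fin n} (h₁ : e₁.eval σ c = j)
    (h₂ : e₂.eval σ c = a) : (NatExpr.rank e₁ e₂).eval σ c = (σ j a : ℕ) := by
  simp only [NatExpr.eval, h₁, h₂, Fin.is_lt, and_self, dif_pos, Fin.eta]

/-- The number register `N_a[0]`. -/
abbrev reg (a : ℕ) : NatExpr := .read a (.lit 0)

/-- The real register `R_a[0]`. -/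
abbrev rreg (a : ℕ) : RealExpr := .read a (.lit 0)

/-- The agent that is stored in `N[i]`. -/
def center (n : ℕ) [NeZero n] (N : ℕ → ℕ) (i : ℕ) : Fin n := Fin.ofNat n (N i)

/-- The agents that are stored in the first `m` entries of `N`. -/
def centerList (n : ℕ) [NeZero n] (N : ℕ → ℕ) (m : ℕ) : List (Fin n) :=
  (List.range m).map (center n N)

variable [NeZero n] {N N' M : ℕ → ℕ} {m : ℕ}

theorem val_center {i : ℕ} (h : N i < n) : (center n N i : ℕ) = N i := Nat.mod_eq_of_lt h

theorem length_centerList : (centerList n N m).length = m := by simp [centerList]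

theorem map_val_centerList (h : ∀ i < m, N i < n) :
    (centerList n N m).map Fin.val = (List.range m).map N := by
  rw [centerList, List.map_map]
  exact List.map_congr_left fun i hi => val_center (h i (List.mem_range.1 hi))

theorem centerList_succ : centerList n N (m + 1) = centerList n N m ++ [center n N m] := by
  simp [centerList, List.range_succ]

theorem centerList_congr (h : ∀ i < m, N i = N' i) : centerList n N m = centerList n N' m :=
  List.map_congr_left fun i hi => by rw [center, center, h i (List.mem_range.1 hi)]

theorem mem_centerList {a : Fin n} :
    a ∈ (centerList n N m).toFinset ↔ ∃ i < m, center n N i = a := by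
  simp [centerList]

/-- Every agent `j` is assigned, by the index `M j`, to its favorite among the first `m` centers in
`N`. The index is `0` as long as there are no centers. -/
def Assigned (σ : Profile n) (N M : ℕ → ℕ) (m : ℕ) : Prop :=
  ∀ j : Fin n, (M j = 0 ∨ M j < m) ∧ ∀ i < m, σ j (center n N (M j)) ≤ σ j (center n N i)

/-- The ordinal information alone identifies the nearest center. -/
theorem Assigned.distTo_eq (h : Assigned σ N M m) (hm : 0 < m) (hd : Consistent d σ) (j : Fin n) :
    distTo d (centerList n N m).toFinset j = d j (center n N (M j)) := by
  obtain ⟨h1, h2⟩ := h j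
  refine distTo_eq_of_forall_le d (mem_centerList.2 ⟨M j, by omega, rfl⟩) fun b hb => ?_
  obtain ⟨i, hi, rfl⟩ := mem_centerList.1 hb
  exact hd j _ _ (h2 i hi)

/-- Compare, for every agent, the new center `N₃[t]`, where `t = N₅[0]`, with the center of the
agent, whose index is in `N₄`. In both mechanisms `N₃` holds the opened centers, `N₄` the assignment
of the agents to them, and `N₅`, `N₆`, `N₇` are the counters of the loops over rounds, agents and
clusters. -/
def reassign : Prog :=
  .forLoop 6 (reg 0)
    (.ite (.natLE (.rank (reg 6) (.read 3 (.read 4 (reg 6)))) (.rank (reg 6) (.read 3 (reg 5))))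
      .skip (.setNat 4 (reg 6) (reg 5)))

theorem runs_reassign {t : ℕ} (hn : c.nat 0 0 = n) (ht : c.nat 5 0 = t)
    (hc : ∀ i ≤ t, c.nat 3 i < n) (hA : Assigned σ (c.nat 3) (c.nat 4) t) :
    Runs σ d reassign c fun c' =>
      Assigned σ (c.nat 3) (c'.nat 4) (t + 1) ∧ c'.real = c.real ∧ c'.log = c.log ∧
        (∀ a, a ≠ 4 → a ≠ 6 → c'.nat a = c.nat a) ∧ c'.steps ≤ c.steps + 1 + 3 * n := by
  have hn' : (reg 0).eval σ c = n := hn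
  refine Runs.forLoop (fun m c' => c'.real = c.real ∧ c'.log = c.log ∧
    (∀ a, a ≠ 4 → a ≠ 6 → c'.nat a = c.nat a) ∧ c'.steps ≤ c.steps + 1 + 3 * m ∧
    (∀ j : Fin n, j < m → c'.nat 4 j < t + 1 ∧ ∀ i < t + 1,
      σ j (center n (c.nat 3) (c'.nat 4 j)) ≤ σ j (center n (c.nat 3) i)) ∧
    ∀ j : Fin n, m ≤ j → c'.nat 4 j = c.nat 4 j) ?_ ?_ ?_
  · exact ⟨rfl, rfl, fun _ _ _ => rfl, le_rfl, fun j hj => absurd hj (Nat.not_lt_zero _),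
      fun _ _ => rfl⟩
  · rintro m hm c' ⟨hreal, hlog, hnat, hsteps, hdone, htodo⟩
    rw [hn'] at hm
    obtain ⟨j, rfl⟩ : ∃ j : Fin n, (j : ℕ) = m := ⟨⟨m, hm⟩, rfl⟩
    obtain ⟨hj1, hj2⟩ := hA j
    have hM : c'.nat 4 j = c.nat 4 j := htodo j le_rfl
    have h3 : c'.nat 3 = c.nat 3 := hnat 3 (by decide) (by decide)
    have h5 : c'.nat 5 0 = t := by rw [hnat 5 (by decide) (by decide), ht]
    set c₁ := (c'.setNat 6 0 j).tick 1 with hc₁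
    have e6 : (reg 6).eval σ c₁ = j := by simp [NatExpr.eval, hc₁]
    have eold : (NatExpr.rank (reg 6) (.read 3 (.read 4 (reg 6)))).eval σ c₁ =
        (σ j (center n (c.nat 3) (c.nat 4 j)) : ℕ) := by
      refine NatExpr.eval_rank e6 ?_
      rw [val_center (hc _ (by omega))]
      simp [NatExpr.eval, hc₁, hM, h3]
    have enew : (NatExpr.rank (reg 6) (.read 3 (reg 5))).eval σ c₁ =
        (σ j (center n (c.nat 3) t) : ℕ) := by
      refine NatExpr.eval_rank e6 ?_
      rw [val_center (hc _ le_rfl)]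
      simp [NatExpr.eval, hc₁, h3, h5]
    refine Runs.ite (fun hb => Runs.skip ?_) (fun hb => Runs.setNat ?_)
    · rw [BoolExpr.eval, eold, enew] at hb
      refine ⟨by simpa [hc₁] using hreal, by simpa [hc₁] using hlog, fun a ha ha' => ?_, ?_,
        fun i hi => ?_, fun i hi => ?_⟩
      · simpa [hc₁, ha'] using hnat a ha ha'
      · simp only [hc₁, Config.steps_tick, Config.steps_setNat]
        omega
      · simp only [hc₁, Config.nat_tick, ne_eq, Nat.reduceEqDiff,
          not_false_eq_true, Config.nat_setNat_array]
        rcases Nat.lt_or_ge i j with h | h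
        · exact hdone i h
        · obtain rfl : i = j := Fin.ext (by omega)
          rw [hM]
          refine ⟨by omega, fun i' hi' => ?_⟩
          rcases Nat.lt_or_ge i' t with h' | h'
          · exact hj2 i' h'
          · obtain rfl : i' = t := by omega
            exact hb
      · simp only [hc₁, Config.nat_tick, ne_eq, Nat.reduceEqDiff,
          not_false_eq_true, Config.nat_setNat_array]
        exact htodo i (by omega)
    · rw [BoolExpr.eval, eold, enew] at hb
      have e5 : (reg 5).eval σ (c₁.tick 1) = t := by simp [NatExpr.eval, hc₁, h5]
      have e6' : (reg 6).eval σ (c₁.tick 1) = j := e6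
      rw [e5, e6']
      refine ⟨by simpa [hc₁] using hreal, by simpa [hc₁] using hlog, fun a ha ha' => ?_, ?_,
        fun i hi => ?_, fun i hi => ?_⟩
      · simpa [hc₁, ha, ha'] using hnat a ha ha'
      · simp only [hc₁, Config.steps_tick, Config.steps_setNat]
        omega
      · rcases Nat.lt_or_ge i j with h | h
        · have : ((c₁.tick 1).setNat 4 j t).nat 4 i = c'.nat 4 i := by
            rw [Config.nat_setNat_index _ _ (by omega)]
            simp [hc₁]
          rw [Config.nat_tick, this]
          exact hdone i h
        · obtain rfl : i = j := Fin.ext (by omega)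
          rw [Config.nat_tick, Config.nat_setNat_self]
          refine ⟨by omega, fun i' hi' => ?_⟩
          rcases Nat.lt_or_ge i' t with h' | h'
          · exact (not_le.1 hb).le.trans (hj2 i' h')
          · obtain rfl : i' = t := by omega
            exact le_rfl
      · rw [Config.nat_tick, Config.nat_setNat_index _ _ (by omega)]
        simpa [hc₁] using htodo i (by omega)
  · rintro c' ⟨hreal, hlog, hnat, hsteps, hdone, -⟩
    rw [hn'] at hsteps hdone
    exact ⟨fun j => ⟨Or.inr (hdone j j.2).1, (hdone j j.2).2⟩, hreal, hlog, hnat, hsteps⟩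

end Assign

/-! ### The farthest-point mechanism -/

section FarthestPoint

variable {n : ℕ} {σ : Profile n} {d : PseudoMetric (Fin n) ℝ} {c : Config n}

/-- Find, in the ranking of the center with index `i = N₇[0]`, the last agent of the cluster of
this center. Its position, plus one, is stored in `N₉[0]`, and its name in `N₁₀[0]`; if the cluster
is empty, then `N₉[0] = 0`. -/
def scanCluster : Prog :=
  .seq (.setNat 9 (.lit 0) (.lit 0)) <|
    .forLoop 6 (reg 0) <|
      .ite (.and (.and (.natLE (.read 4 (reg 6)) (reg 7)) (.natLE (reg 7) (.read 4 (reg 6))))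
          (.natLE (reg 9) (.rank (.read 3 (reg 7)) (reg 6))))
        (.seq (.setNat 9 (.lit 0) (.add (.rank (.read 3 (reg 7)) (reg 6)) (.lit 1)))
          (.setNat 10 (.lit 0) (reg 6)))
        .skip

/-- Ask the agent found by `scanCluster` for its distance to the center of its cluster, and keep
the agent in `N₈[0]` and the distance in `R₂[0]` if it is the farthest so far. The comparison is not
strict, so that the first nonempty cluster always replaces the initial distance `0`. -/
def probeCluster : Prog :=
  .ite (.natLE (.lit 1) (reg 9))
    (.seq (.query 3 (.lit 0) (reg 10) (.read 3 (reg 7)))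
      (.ite (.realLE (rreg 2) (rreg 3))
        (.seq (.setReal 2 (.lit 0) (rreg 3)) (.setNat 8 (.lit 0) (reg 10)))
        .skip))
    .skip

/-- Find an agent that is farthest from the first `N₅[0] + 1` centers. -/
def findFarthest : Prog :=
  .seq (.setReal 2 (.lit 0) (.ofNat (.lit 0)))
    (.forLoop 7 (.add (reg 5) (.lit 1)) (.seq scanCluster probeCluster))

/-- Open the agent in `N₈[0]` (initially `0`, later a farthest one) as a new center. -/
def farthestRound : Prog :=
  .seq (.setNat 3 (reg 5) (reg 8)) (.seq reassign findFarthest)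

/-- The farthest-point mechanism; the multiplication by `ℓ` is a repeated addition. -/
def farthestPointProg : Prog :=
  .seq (.forLoop 5 (reg 1) farthestRound)
    (.forLoop 6 (reg 2) (.setReal 0 (.lit 0) (.add (rreg 0) (rreg 2))))

variable [NeZero n]

theorem runs_scanCluster {i : ℕ} (hn : c.nat 0 0 = n) (hi : c.nat 7 0 = i)
    (hc : c.nat 3 i < n) :
    Runs σ d scanCluster c fun c' =>
      c'.real = c.real ∧ c'.log = c.log ∧
        (∀ a, a ≠ 6 → a ≠ 9 → a ≠ 10 → c'.nat a = c.nat a) ∧ c'.steps ≤ c.steps + 2 + 4 * n ∧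
        (∀ j : Fin n, c.nat 4 j = i → (σ (center n (c.nat 3) i) j : ℕ) + 1 ≤ c'.nat 9 0) ∧
        (c'.nat 9 0 = 0 ∨ ∃ j : Fin n, c.nat 4 j = i ∧ c'.nat 10 0 = j ∧
          c'.nat 9 0 = σ (center n (c.nat 3) i) j + 1) := by
  refine Runs.seq (Runs.setNat ?_)
  set c₀ := (c.setNat 9 ((NatExpr.lit 0).eval σ c) ((NatExpr.lit 0).eval σ c)).tick 1 with hc₀
  have hn' : (reg 0).eval σ c₀ = n := by simpa [NatExpr.eval, hc₀] using hn
  refine Runs.forLoop (fun m c' => c'.real = c.real ∧ c'.log = c.log ∧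
    (∀ a, a ≠ 6 → a ≠ 9 → a ≠ 10 → c'.nat a = c.nat a) ∧ c'.steps ≤ c.steps + 2 + 4 * m ∧
    (∀ j : Fin n, j < m → c.nat 4 j = i → (σ (center n (c.nat 3) i) j : ℕ) + 1 ≤ c'.nat 9 0) ∧
    (c'.nat 9 0 = 0 ∨ ∃ j : Fin n, c.nat 4 j = i ∧ c'.nat 10 0 = j ∧
      c'.nat 9 0 = σ (center n (c.nat 3) i) j + 1)) ?_ ?_ ?_
  · refine ⟨rfl, rfl, fun a _ h9 _ => ?_, le_rfl, fun j hj => absurd hj (Nat.not_lt_zero _),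
      Or.inl ?_⟩
    · simp [hc₀, h9]
    · simp [hc₀, NatExpr.eval]
  · rintro m hm c' ⟨hreal, hlog, hnat, hsteps, hmax, harg⟩
    rw [hn'] at hm
    obtain ⟨j, rfl⟩ : ∃ j : Fin n, (j : ℕ) = m := ⟨⟨m, hm⟩, rfl⟩
    have h3 : c'.nat 3 = c.nat 3 := hnat 3 (by decide) (by decide) (by decide)
    have h4 : c'.nat 4 = c.nat 4 := hnat 4 (by decide) (by decide) (by decide)
    have h7 : c'.nat 7 0 = i := by rw [hnat 7 (by decide) (by decide) (by decide), hi]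
    set c₁ := (c'.setNat 6 0 j).tick 1 with hc₁
    have e4 : (NatExpr.read 4 (reg 6)).eval σ c₁ = c.nat 4 j := by simp [NatExpr.eval, hc₁, h4]
    have e7 : (reg 7).eval σ c₁ = i := by simp [NatExpr.eval, hc₁, h7]
    have e9 : (reg 9).eval σ c₁ = c'.nat 9 0 := by simp [NatExpr.eval, hc₁]
    have erank : (NatExpr.rank (.read 3 (reg 7)) (reg 6)).eval σ c₁ =
        (σ (center n (c.nat 3) i) j : ℕ) := by
      refine NatExpr.eval_rank ?_ (by simp [NatExpr.eval, hc₁])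
      rw [val_center hc]
      simp [NatExpr.eval, hc₁, h3, h7]
    refine Runs.ite (fun hb => ?_) (fun hb => Runs.skip ?_)
    · simp only [BoolExpr.eval] at hb
      rw [e4, e7, e9, erank] at hb
      refine Runs.seq (Runs.setNat (Runs.setNat ?_))
      have er : (NatExpr.add (.rank (.read 3 (reg 7)) (reg 6)) (.lit 1)).eval σ (c₁.tick 1) =
          (σ (center n (c.nat 3) i) j : ℕ) + 1 := congrArg (· + 1) erank
      rw [er]
      have e0 : ∀ x : Config n, (NatExpr.lit 0).eval σ x = 0 := fun _ => rfl
      rw [e0, e0]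
      have e6 : (reg 6).eval σ (((c₁.tick 1).setNat 9 0
          ((σ (center n (c.nat 3) i) j : ℕ) + 1)).tick 1) = j := by simp [NatExpr.eval, hc₁]
      rw [e6]
      refine ⟨by simpa [hc₁] using hreal, by simpa [hc₁] using hlog, fun a h6 h9 h10 => ?_, ?_,
        fun j' hj' hj'i => ?_, Or.inr ⟨j, by omega, by simp, by simp⟩⟩
      · simpa [hc₁, h6, h9, h10] using hnat a h6 h9 h10
      · simp only [hc₁, Config.steps_tick, Config.steps_setNat]
        omega
      · simp only [Config.nat_tick, ne_eq, Nat.reduceEqDiff, not_false_eq_true,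
          Config.nat_setNat_array, Config.nat_setNat_self]
        rcases Nat.lt_or_ge j' j with h | h
        · have := hmax j' h hj'i
          omega
        · obtain rfl : j' = j := Fin.ext (by omega)
          exact le_rfl
    · simp only [BoolExpr.eval] at hb
      rw [e4, e7, e9, erank] at hb
      refine ⟨by simpa [hc₁] using hreal, by simpa [hc₁] using hlog, fun a h6 h9 h10 => ?_, ?_,
        fun j' hj' hj'i => ?_, by simpa [hc₁] using harg⟩
      · simpa [hc₁, h6] using hnat a h6 h9 h10
      · simp only [hc₁, Config.steps_tick, Config.steps_setNat]
        omega
      · simp only [hc₁, Config.nat_tick, ne_eq, Nat.reduceEqDiff, not_false_eq_true,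
          Config.nat_setNat_array]
        rcases Nat.lt_or_ge j' j with h | h
        · exact hmax j' h hj'i
        · obtain rfl : j' = j := Fin.ext (by omega)
          omega
  · rintro c' ⟨hreal, hlog, hnat, hsteps, hmax, harg⟩
    rw [hn'] at hsteps hmax
    exact ⟨hreal, hlog, hnat, hsteps, fun j => hmax j j.2, harg⟩

/-- The last agent of a cluster in the ranking of its center is the farthest one, because the
distance is symmetric. -/
theorem runs_scan_probeCluster (hd : Consistent d σ) {i : ℕ} (hn : c.nat 0 0 = n)
    (hi : c.nat 7 0 = i) (hc : c.nat 3 i < n) :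
    Runs σ d (.seq scanCluster probeCluster) c fun c' =>
      (∀ a, a ≠ 2 → a ≠ 3 → c'.real a = c.real a) ∧
      (∀ a, a ≠ 6 → a ≠ 8 → a ≠ 9 → a ≠ 10 → c'.nat a = c.nat a) ∧
      c'.steps ≤ c.steps + 7 + 4 * n ∧
      (((∀ j : Fin n, c.nat 4 j ≠ i) ∧ c'.log = c.log ∧ c'.real 2 0 = c.real 2 0 ∧
          c'.nat 8 0 = c.nat 8 0) ∨
        ∃ j : Fin n, c.nat 4 j = i ∧
          (∀ j' : Fin n, c.nat 4 j' = i →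
            d j' (center n (c.nat 3) i) ≤ d j (center n (c.nat 3) i)) ∧
          c'.log = (j, center n (c.nat 3) i) :: c.log ∧
          ((c.real 2 0 ≤ d j (center n (c.nat 3) i) ∧
              c'.real 2 0 = d j (center n (c.nat 3) i) ∧ c'.nat 8 0 = j) ∨
            (d j (center n (c.nat 3) i) < c.real 2 0 ∧ c'.real 2 0 = c.real 2 0 ∧
              c'.nat 8 0 = c.nat 8 0))) := by
  refine Runs.seq ((runs_scanCluster hn hi hc).mono ?_)
  rintro c₁ ⟨hreal, hlog, hnat, hsteps, hmax, harg⟩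
  have h3 : c₁.nat 3 = c.nat 3 := hnat 3 (by decide) (by decide) (by decide)
  have h7 : c₁.nat 7 0 = i := by rw [hnat 7 (by decide) (by decide) (by decide), hi]
  have h8 : c₁.nat 8 = c.nat 8 := hnat 8 (by decide) (by decide) (by decide)
  refine Runs.ite (fun hb => ?_) (fun hb => Runs.skip ?_)
  · simp only [BoolExpr.eval, NatExpr.eval] at hb
    obtain ⟨j, hj, h10, h9⟩ := harg.resolve_left (by omega)
    refine Runs.seq (Runs.query ?_)
    have e10 : (reg 10).eval σ (c₁.tick 1) = j := h10
    have e3 : (NatExpr.read 3 (reg 7)).eval σ (c₁.tick 1) = center n (c.nat 3) i := by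
      rw [val_center hc]
      simp [NatExpr.eval, h3, h7]
    have e0 : ∀ x : Config n, (NatExpr.lit 0).eval σ x = 0 := fun _ => rfl
    rw [e10, e3, e0, Config.ask_of_fin]
    set c₂ : Config n := Config.tick { (c₁.tick 1).setReal 3 0 (d j (center n (c.nat 3) i)) with
      log := (j, center n (c.nat 3) i) :: (c₁.tick 1).log } 1 with hc₂
    have hnat₂ : c₂.nat = c₁.nat := rfl
    have hreal₂ : c₂.real = ((c₁.tick 1).setReal 3 0 (d j (center n (c.nat 3) i))).real := rfl
    have hlog₂ : c₂.log = (j, center n (c.nat 3) i) :: c.log := by rw [← hlog]; rfl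
    have hsteps₂ : c₂.steps = c₁.steps + 2 := rfl
    have hfar : ∀ j' : Fin n, c.nat 4 j' = i →
        d j' (center n (c.nat 3) i) ≤ d j (center n (c.nat 3) i) := by
      intro j' hj'
      rw [d.symm j', d.symm j]
      refine hd _ _ _ ?_
      have := hmax j' hj'
      rw [h9] at this
      exact Fin.le_def.2 (by omega)
    have r2 : (rreg 2).eval σ c₂ = c.real 2 0 := by
      simp [RealExpr.eval, NatExpr.eval, hreal₂, hreal]
    have r3 : (rreg 3).eval σ c₂ = d j (center n (c.nat 3) i) := by
      simp [RealExpr.eval, NatExpr.eval, hreal₂]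
    refine Runs.ite (fun hb' => ?_) (fun hb' => Runs.skip ?_)
    · rw [BoolExpr.eval, r2, r3] at hb'
      refine Runs.seq (Runs.setReal (Runs.setNat ?_))
      have r3' : (rreg 3).eval σ (c₂.tick 1) = d j (center n (c.nat 3) i) := r3
      rw [e0, e0, r3']
      have e10' : (reg 10).eval σ (((c₂.tick 1).setReal 2 0
          (d j (center n (c.nat 3) i))).tick 1) = j := h10
      rw [e10']
      refine ⟨fun a h2 h3 => ?_, fun a h6 h8 h9 h10 => ?_, ?_, Or.inr ⟨j, hj, hfar, ?_, Or.inl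
        ⟨hb', ?_, ?_⟩⟩⟩
      · simp [hreal₂, h2, h3, hreal]
      · simpa [hnat₂, h8] using hnat a h6 h9 h10
      · simp only [Config.steps_tick, Config.steps_setNat, Config.steps_setReal]
        omega
      · simpa using hlog₂
      · simp
      · simp
    · rw [BoolExpr.eval, r2, r3, not_le] at hb'
      refine ⟨fun a h2 h3 => ?_, fun a h6 h8 h9 h10 => ?_, ?_, Or.inr ⟨j, hj, hfar, ?_, Or.inr
        ⟨hb', ?_, ?_⟩⟩⟩
      · simp [hreal₂, h3, hreal]
      · simpa [hnat₂] using hnat a h6 h9 h10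
      · simp only [Config.steps_tick]
        omega
      · simpa using hlog₂
      · simp [hreal₂, hreal]
      · simp [hnat₂, h8]
  · simp only [BoolExpr.eval, NatExpr.eval] at hb
    refine ⟨fun a _ _ => by simp [hreal], fun a h6 _ h9 h10 => by simpa using hnat a h6 h9 h10, ?_,
      Or.inl ⟨fun j hj => ?_, by simpa using hlog, by simp [hreal], by simp [h8]⟩⟩
    · simp only [Config.steps_tick]
      omega
    · have := hmax j hj
      omega

/-- An agent belongs to one cluster, so that it is asked at most once. -/
theorem runs_findFarthest (hd : Consistent d σ) {t : ℕ} (hn : c.nat 0 0 = n)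
    (ht : c.nat 5 0 = t) (hc : ∀ i ≤ t, c.nat 3 i < n)
    (hA : Assigned σ (c.nat 3) (c.nat 4) (t + 1)) :
    Runs σ d findFarthest c fun c' =>
      (∀ a, a ≠ 2 → a ≠ 3 → c'.real a = c.real a) ∧
      (∀ a, a ≠ 6 → a ≠ 7 → a ≠ 8 → a ≠ 9 → a ≠ 10 → c'.nat a = c.nat a) ∧
      c'.steps ≤ c.steps + 2 + (t + 1) * (8 + 4 * n) ∧
      (∀ j, c'.queriesTo j ≤ c.queriesTo j + 1) ∧
      c'.totalQueries ≤ c.totalQueries + (t + 1) ∧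
      ∃ p : Fin n, c'.nat 8 0 = p ∧
        c'.real 2 0 = distTo d (centerList n (c.nat 3) (t + 1)).toFinset p ∧
        ∀ j, distTo d (centerList n (c.nat 3) (t + 1)).toFinset j ≤ c'.real 2 0 := by
  have hdist := hA.distTo_eq t.succ_pos hd
  have hlt : ∀ j : Fin n, c.nat 4 j < t + 1 := fun j => by have := (hA j).1; omega
  refine Runs.seq (Runs.setReal ?_)
  set c₀ := (c.setReal 2 ((NatExpr.lit 0).eval σ c) ((RealExpr.ofNat (.lit 0)).eval σ c)).tick 1
    with hc₀
  have ht' : (NatExpr.add (reg 5) (.lit 1)).eval σ c₀ = t + 1 := congrArg (· + 1) ht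
  refine Runs.forLoop (fun i c' => (∀ a, a ≠ 2 → a ≠ 3 → c'.real a = c.real a) ∧
      (∀ a, a ≠ 6 → a ≠ 7 → a ≠ 8 → a ≠ 9 → a ≠ 10 → c'.nat a = c.nat a) ∧
      c'.steps ≤ c.steps + 2 + i * (8 + 4 * n) ∧
      (∀ j, c'.queriesTo j ≤ c.queriesTo j + if c.nat 4 j < i then 1 else 0) ∧
      c'.totalQueries ≤ c.totalQueries + i ∧
      ((c'.real 2 0 = 0 ∧ ∀ j : Fin n, i ≤ c.nat 4 j) ∨
        ∃ p : Fin n, c'.nat 8 0 = p ∧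
          c'.real 2 0 = d p (center n (c.nat 3) (c.nat 4 p)) ∧
          ∀ j : Fin n, c.nat 4 j < i → d j (center n (c.nat 3) (c.nat 4 j)) ≤ c'.real 2 0))
    ?_ ?_ ?_
  · refine ⟨fun a h2 _ => by simp [hc₀, h2], fun _ _ _ _ _ _ => rfl, by simp [hc₀],
      fun j => Nat.le_add_right _ _, Nat.le_add_right _ _, Or.inl ⟨?_, fun j => Nat.zero_le _⟩⟩
    simp [hc₀, NatExpr.eval, RealExpr.eval]
  · rintro i hi c' ⟨hreal, hnat, hsteps, hq, htot, hbest⟩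
    rw [ht'] at hi
    have h0 : c'.nat 0 0 = n := by
      rw [hnat 0 (by decide) (by decide) (by decide) (by decide) (by decide), hn]
    have h3 : c'.nat 3 = c.nat 3 :=
      hnat 3 (by decide) (by decide) (by decide) (by decide) (by decide)
    have h4 : c'.nat 4 = c.nat 4 :=
      hnat 4 (by decide) (by decide) (by decide) (by decide) (by decide)
    set c₁ := (c'.setNat 7 0 i).tick 1 with hc₁
    have k3 : c₁.nat 3 = c.nat 3 := by simp [hc₁, h3]
    have k4 : c₁.nat 4 = c.nat 4 := by simp [hc₁, h4]
    refine (runs_scan_probeCluster (c := c₁) (i := i) hd (by simp [hc₁, h0]) (by simp [hc₁])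
      (by rw [k3]; exact hc i (by omega))).mono ?_
    rintro c₂ ⟨hreal₂, hnat₂, hsteps₂, hcase⟩
    rw [k3, k4] at hcase
    have hlog₁ : c₁.log = c'.log := rfl
    have hreal₁ : c₁.real = c'.real := rfl
    have h8₁ : c₁.nat 8 0 = c'.nat 8 0 := by simp [hc₁]
    rw [hlog₁, hreal₁, h8₁] at hcase
    refine ⟨fun a h2 h3 => (hreal₂ a h2 h3).trans (hreal a h2 h3),
      fun a h6 h7 h8 h9 h10 => ?_, ?_, ?_⟩
    · rw [hnat₂ a h6 h8 h9 h10, ← hnat a h6 h7 h8 h9 h10]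
      simp [hc₁, h7]
    · simp only [hc₁, Config.steps_tick, Config.steps_setNat] at hsteps₂
      rw [Nat.succ_mul]
      omega
    rcases hcase with ⟨hempty, hlog₂, h2, h8⟩ | ⟨p, hp, hfar, hlog₂, hupd⟩
    · refine ⟨fun j => ?_, ?_, ?_⟩
      · have h := hq j
        rw [Config.queriesTo, hlog₂]
        rw [Config.queriesTo] at h
        refine h.trans (Nat.add_le_add_left ?_ _)
        split_ifs <;> omega
      · rw [Config.totalQueries, hlog₂]
        rw [Config.totalQueries] at htot
        omega
      · rw [h2, h8]
        rcases hbest with ⟨hz, hb⟩ | ⟨p, hp8, hp2, hb⟩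
        · exact Or.inl ⟨hz, fun j => Nat.lt_of_le_of_ne (hb j) (hempty j).symm⟩
        · exact Or.inr ⟨p, hp8, hp2, fun j hj =>
            hb j (Nat.lt_of_le_of_ne (Nat.lt_succ_iff.1 hj) (hempty j))⟩
    · refine ⟨fun j => ?_, ?_, ?_⟩
      · have h := hq j
        rw [Config.queriesTo, hlog₂, List.countP_cons]
        rw [Config.queriesTo] at h
        by_cases hjp : p = j
        · subst hjp
          rw [if_neg (by omega)] at h
          rw [if_pos (by simp), if_pos (by omega)]
          omega
        · rw [if_neg (by simpa using hjp), Nat.add_zero]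
          refine h.trans (Nat.add_le_add_left ?_ _)
          split_ifs <;> omega
      · rw [Config.totalQueries, hlog₂, List.length_cons]
        rw [Config.totalQueries] at htot
        omega
      · refine Or.inr ?_
        rcases hupd with ⟨hle, h2, h8⟩ | ⟨hgt, h2, h8⟩
        · refine ⟨p, h8, by rw [h2, hp], fun j hj => ?_⟩
          rw [h2]
          rcases Nat.lt_or_ge (c.nat 4 j) i with h | h
          · rcases hbest with ⟨-, hb⟩ | ⟨_, -, -, hb⟩
            · have := hb j
              omega
            · exact (hb j h).trans hle
          · have hji : c.nat 4 j = i := by omega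
            rw [hji]
            exact hfar j hji
        · rw [h2, h8]
          rcases hbest with ⟨hz, -⟩ | ⟨p', hp8, hp2, hb⟩
          · rw [hz] at hgt
            exact absurd hgt (not_lt.2 (d.nonneg _ _))
          · refine ⟨p', hp8, hp2, fun j hj => ?_⟩
            rcases Nat.lt_or_ge (c.nat 4 j) i with h | h
            · exact hb j h
            · have hji : c.nat 4 j = i := by omega
              rw [hji]
              exact (hfar j hji).trans hgt.le
  · rintro c' ⟨hreal, hnat, hsteps, hq, htot, hbest⟩
    rw [ht'] at hsteps htot hbest
    refine ⟨hreal, hnat, hsteps, fun j => (hq j).trans (Nat.add_le_add_left ?_ _), htot, ?_⟩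
    · split_ifs <;> omega
    · rcases hbest with ⟨-, hb⟩ | ⟨p, hp8, hp2, hb⟩
      · have h1 := hb (center n (c.nat 3) 0)
        have h2 := hlt (center n (c.nat 3) 0)
        omega
      · exact ⟨p, hp8, by rw [hp2, hdist], fun j => by rw [hdist]; exact hb j (hlt j)⟩

/-- The invariant of the main loop after `t` rounds. -/
structure FarthestInv (σ : Profile n) (d : PseudoMetric (Fin n) ℝ) (k l t : ℕ) (c : Config n) :
    Prop where
  size : c.nat 0 0 = n
  weight : c.nat 2 0 = l
  acc : c.real 0 0 = 0
  valid : ∀ i < t, c.nat 3 i < n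
  next_valid : c.nat 8 0 < n
  assigned : Assigned σ (c.nat 3) (c.nat 4) t
  run : ∀ m, 0 < m → m < t → ∀ j, distTo d (centerList n (c.nat 3) m).toFinset j ≤
    distTo d (centerList n (c.nat 3) m).toFinset (center n (c.nat 3) m)
  next : 0 < t → c.real 2 0 = distTo d (centerList n (c.nat 3) t).toFinset (center n (c.nat 8) 0) ∧
    ∀ j, distTo d (centerList n (c.nat 3) t).toFinset j ≤ c.real 2 0
  queries : ∀ j, c.queriesTo j ≤ t
  total : c.totalQueries ≤ t * k
  time : c.steps ≤ 1 + t * (5 + 3 * n + k * (8 + 4 * n))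

theorem runs_farthestRound (hd : Consistent d σ) {k l t : ℕ} (htk : t < k)
    (h : FarthestInv σ d k l t c) :
    Runs σ d farthestRound ((c.setNat 5 0 t).tick 1) (FarthestInv σ d k l (t + 1)) := by
  refine Runs.seq (Runs.setNat ?_)
  have e5 : (reg 5).eval σ ((c.setNat 5 0 t).tick 1) = t := by simp [NatExpr.eval]
  have e8 : (reg 8).eval σ ((c.setNat 5 0 t).tick 1) = c.nat 8 0 := by simp [NatExpr.eval]
  rw [e5, e8]
  set c₁ := (((c.setNat 5 0 t).tick 1).setNat 3 t (c.nat 8 0)).tick 1 with hc₁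
  have h3t : c₁.nat 3 t = c.nat 8 0 := by simp [hc₁]
  have h3 : ∀ i < t, c₁.nat 3 i = c.nat 3 i := fun i hi => by
    rw [hc₁, Config.nat_tick, Config.nat_setNat_index _ _ (by omega)]
    simp
  have hvalid : ∀ i ≤ t, c₁.nat 3 i < n := fun i hi => by
    rcases Nat.lt_or_ge i t with h' | h'
    · rw [h3 i h']
      exact h.valid i h'
    · obtain rfl : i = t := by omega
      rw [h3t]
      exact h.next_valid
  have hcl : ∀ m ≤ t, centerList n (c₁.nat 3) m = centerList n (c.nat 3) m := fun m hm =>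
    centerList_congr fun i hi => h3 i (by omega)
  have h4 : c₁.nat 4 = c.nat 4 := by simp [hc₁]
  have hA : Assigned σ (c₁.nat 3) (c₁.nat 4) t := by
    intro j
    obtain ⟨h1, h2⟩ := h.assigned j
    rw [h4]
    refine ⟨h1, fun i hi => ?_⟩
    have := h2 i hi
    rwa [center, center, h3 i hi, h3 _ (by omega)]
  refine Runs.seq ((runs_reassign (c := c₁) (t := t) (by simpa [hc₁] using h.size) (by simp [hc₁])
    hvalid hA).mono ?_)
  rintro c₂ ⟨hA₂, hreal₂, hlog₂, hnat₂, hsteps₂⟩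
  have k3 : c₂.nat 3 = c₁.nat 3 := hnat₂ 3 (by decide) (by decide)
  refine (runs_findFarthest (c := c₂) (t := t) hd ?_ ?_ (by rwa [k3]) (by rwa [k3])).mono ?_
  · rw [hnat₂ 0 (by decide) (by decide)]
    simpa [hc₁] using h.size
  · rw [hnat₂ 5 (by decide) (by decide)]
    simp [hc₁]
  rintro c₃ ⟨hreal₃, hnat₃, hsteps₃, hq₃, htot₃, p, hp8, hp2, hfar⟩
  have hnat : ∀ a, a ≠ 3 → a ≠ 4 → a ≠ 5 → a ≠ 6 → a ≠ 7 → a ≠ 8 → a ≠ 9 → a ≠ 10 →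
      c₃.nat a = c.nat a := fun a h3 h4 h5 h6 h7 h8 h9 h10 => by
    rw [hnat₃ a h6 h7 h8 h9 h10, hnat₂ a h4 h6]
    simp [hc₁, h3, h5]
  have m3 : c₃.nat 3 = c₁.nat 3 := by
    rw [hnat₃ 3 (by decide) (by decide) (by decide) (by decide) (by decide), k3]
  have m4 : c₃.nat 4 = c₂.nat 4 :=
    hnat₃ 4 (by decide) (by decide) (by decide) (by decide) (by decide)
  have hlog : c₂.log = c.log := hlog₂
  rw [k3] at hp2 hfar
  constructor
  · rw [hnat 0 (by decide) (by decide) (by decide) (by decide) (by decide) (by decide) (by decide)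
      (by decide), h.size]
  · rw [hnat 2 (by decide) (by decide) (by decide) (by decide) (by decide) (by decide) (by decide)
      (by decide), h.weight]
  · rw [hreal₃ 0 (by decide) (by decide), hreal₂]
    exact h.acc
  · rw [m3]
    exact fun i hi => hvalid i (by omega)
  · rw [hp8]
    exact p.2
  · rw [m3, m4]
    exact hA₂
  · intro m hm hmt j
    rw [m3, hcl m (by omega)]
    rcases Nat.lt_or_ge m t with h' | h'
    · rw [center, h3 m h']
      exact h.run m hm h' j
    · obtain rfl : m = t := by omega
      obtain ⟨h1, h2⟩ := h.next hm
      have hcen : center n (c₁.nat 3) m = center n (c.nat 8) 0 := by rw [center, center, h3t]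
      rw [hcen, ← h1]
      exact h2 j
  · intro _
    have hcp : center n (c₃.nat 8) 0 = p :=
      Fin.ext ((val_center (by rw [hp8]; exact p.2)).trans hp8)
    rw [m3, hcp]
    exact ⟨hp2, hfar⟩
  · intro j
    have h1 := hq₃ j
    have h2 := h.queries j
    rw [Config.queriesTo, Config.queriesTo, hlog] at h1
    rw [Config.queriesTo] at h2 ⊢
    omega
  · have h2 := h.total
    rw [Config.totalQueries, Config.totalQueries, hlog] at htot₃
    rw [Config.totalQueries] at h2 ⊢
    rw [Nat.succ_mul]
    omega
  · have h1 : c₁.steps = c.steps + 2 := rfl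
    have h2 := h.time
    have h4 : (t + 1) * (8 + 4 * n) ≤ k * (8 + 4 * n) := Nat.mul_le_mul_right _ htk
    rw [Nat.succ_mul]
    omega

theorem runs_farthestPointProg (hd : Consistent d σ) (k l : ℕ) :
    Runs σ d farthestPointProg (Config.init n k l) fun c =>
      ∃ c₁, FarthestInv σ d k l k c₁ ∧ c.nat 3 = c₁.nat 3 ∧ c.log = c₁.log ∧
        c.estimate = l * c₁.real 2 0 ∧ c.steps ≤ c₁.steps + 1 + 2 * l := by
  refine Runs.seq (Runs.forLoop (FarthestInv σ d k l) ?_ ?_ ?_)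
  · exact ⟨rfl, rfl, rfl, fun i hi => absurd hi (Nat.not_lt_zero _), Nat.pos_of_neZero n,
      fun j => ⟨Or.inl (by simp [Config.init]), fun i hi => absurd hi (Nat.not_lt_zero _)⟩,
      fun m _ hm => absurd hm (Nat.not_lt_zero _), fun h => absurd h (Nat.not_lt_zero _),
      fun j => le_rfl, Nat.zero_le _, by simp [Config.init]⟩
  · exact fun t ht c' h => runs_farthestRound hd ht h
  · intro c₁ h
    have h' : FarthestInv σ d k l k c₁ := h
    have hl : (reg 2).eval σ c₁ = l := h'.weight
    refine Runs.forLoop (fun m c => c.nat 3 = c₁.nat 3 ∧ c.log = c₁.log ∧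
      c.real 0 0 = m * c₁.real 2 0 ∧ c.real 2 = c₁.real 2 ∧ c.steps ≤ c₁.steps + 1 + 2 * m) ?_ ?_ ?_
    · exact ⟨rfl, rfl, by simpa using h'.acc, rfl, le_rfl⟩
    · rintro m - c ⟨h3, hlog, h0, h2, hsteps⟩
      refine Runs.setReal ⟨by simpa using h3, by simpa using hlog, ?_, by simpa using h2, ?_⟩
      · simp only [NatExpr.eval, RealExpr.eval, Config.real_tick, Config.real_setNat,
          Config.real_setReal_self, h0, h2]
        push_cast
        ring
      · simp only [Config.steps_tick, Config.steps_setNat, Config.steps_setReal]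
        omega
    · rintro c ⟨h3, hlog, h0, -, hsteps⟩
      rw [hl] at h0 hsteps
      exact ⟨c₁, h', h3, hlog, h0, hsteps⟩

/-- The properties of the farthest-point mechanism, with explicit bounds. -/
theorem farthestPointProg_spec (hd : Consistent d σ) {k l : ℕ} (hk : 1 ≤ k) (hl : 1 ≤ l)
    (hln : l ≤ n) :
    ∃ (c : Config n) (s : List (Fin n)),
      farthestPointProg.run k l σ d = PMF.pure c ∧
      s.length = k ∧ IsFarthestPointRun d s ∧
      c.centers k = s.map Fin.val ∧
      c.estimate = (l : ℝ) * centerCost d s.toFinset ∧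
      opt d k l ≤ c.estimate ∧
      c.estimate ≤ 2 * (l : ℝ) * opt d k l ∧
      (∀ i : Fin n, c.queriesTo i ≤ k) ∧
      c.totalQueries ≤ k ^ 2 ∧
      c.steps ≤ 2 + k * (5 + 3 * n + k * (8 + 4 * n)) + 2 * l := by
  obtain ⟨c, hrun, c₁, h, h3, hlog, hest, hsteps⟩ := runs_farthestPointProg hd k l
  have hs : IsFarthestPointRun d (centerList n (c₁.nat 3) k) := by
    intro t ht ht0 j
    rw [length_centerList] at ht
    have htake : (centerList n (c₁.nat 3) k).take t = centerList n (c₁.nat 3) t := by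
      rw [centerList, ← List.map_take, List.take_range, min_eq_left ht.le, centerList]
    have hget : (centerList n (c₁.nat 3) k)[t]'(by rwa [length_centerList]) =
        center n (c₁.nat 3) t := by
      simp [centerList]
    rw [htake, hget]
    exact h.run t ht0 ht j
  have hcost : c₁.real 2 0 = centerCost d (centerList n (c₁.nat 3) k).toFinset := by
    obtain ⟨h1, h2⟩ := h.next hk
    exact le_antisymm (h1.trans_le (distTo_le_centerCost d _ _)) (centerCost_le d h2)
  have hest' : c.estimate = l * centerCost d (centerList n (c₁.nat 3) k).toFinset := by
    rw [hest, hcost]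
  obtain ⟨hlow, hupp⟩ := farthestPoint_sandwich d hk hl hln hs length_centerList
  refine ⟨c, centerList n (c₁.nat 3) k, hrun, length_centerList, hs, ?_, hest', by rwa [hest'],
    by rwa [hest'], fun i => ?_, ?_, ?_⟩
  · rw [map_val_centerList h.valid, Config.centers, h3]
  · rw [Config.queriesTo, hlog]
    exact h.queries i
  · rw [Config.totalQueries, hlog, pow_two]
    exact h.total
  · have := h.time
    omega

end FarthestPoint

/-! ### The `k`-means++ mechanism -/

section KMeansPPMechanism

variable {n : ℕ} {σ : Profile n} {d : PseudoMetric (Fin n) ℝ} {c : Config n}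

/-- Ask every agent for the distance to its nearest center, and store the answers in `R₁`. -/
def measure : Prog :=
  .forLoop 6 (reg 0) (.query 1 (reg 6) (reg 6) (.read 3 (.read 4 (reg 6))))

/-- Open a new center, drawn with the weights in `R₁`, and update the weights. Initially all
weights are `0`, so that the first center is uniform. -/
def kMeansRound : Prog :=
  .seq (.sample 3 (reg 5) 1 (reg 0)) (.seq reassign measure)

/-- The `k`-means++ mechanism; in the end, the weights are added up. -/
def kMeansProg : Prog :=
  .seq (.forLoop 5 (reg 1) kMeansRound)
    (.forLoop 6 (reg 0) (.setReal 0 (.lit 0) (.add (rreg 0) (.read 1 (reg 6)))))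

variable [NeZero n]

theorem drawIndex_eq (w : ℕ → ℝ) :
    drawIndex n w = (proportional fun j : Fin n => w j).map Fin.val := by
  cases n with
  | zero => exact absurd rfl (NeZero.ne 0)
  | succ m => exact PMF.map_id ((proportional fun j : Fin (m + 1) => w j).map Fin.val)

theorem runs_measure {M : ℕ → ℕ} (hn : c.nat 0 0 = n) (h4 : c.nat 4 = M)
    (hc : ∀ j : Fin n, c.nat 3 (M j) < n) :
    Runs σ d measure c fun c' =>
      (∀ j : Fin n, c'.real 1 j = d j (center n (c.nat 3) (M j))) ∧
      (∀ a, a ≠ 1 → c'.real a = c.real a) ∧ (∀ a, a ≠ 6 → c'.nat a = c.nat a) ∧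
      (∀ j, c'.queriesTo j ≤ c.queriesTo j + 1) ∧ c'.steps ≤ c.steps + 1 + 2 * n := by
  have hn' : (reg 0).eval σ c = n := hn
  refine Runs.forLoop (fun m c' =>
    (∀ j : Fin n, j < m → c'.real 1 j = d j (center n (c.nat 3) (M j))) ∧
    (∀ a, a ≠ 1 → c'.real a = c.real a) ∧ (∀ a, a ≠ 6 → c'.nat a = c.nat a) ∧
    (∀ j, c'.queriesTo j ≤ c.queriesTo j + if (j : ℕ) < m then 1 else 0) ∧
    c'.steps ≤ c.steps + 1 + 2 * m) ?_ ?_ ?_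
  · exact ⟨fun j hj => absurd hj (Nat.not_lt_zero _), fun _ _ => rfl, fun _ _ => rfl,
      fun j => Nat.le_add_right _ _, le_rfl⟩
  · rintro m hm c' ⟨hdone, hreal, hnat, hq, hsteps⟩
    rw [hn'] at hm
    obtain ⟨j, rfl⟩ : ∃ j : Fin n, (j : ℕ) = m := ⟨⟨m, hm⟩, rfl⟩
    have k3 : c'.nat 3 = c.nat 3 := hnat 3 (by decide)
    have k4 : c'.nat 4 = M := (hnat 4 (by decide)).trans h4
    refine Runs.query ?_
    have e6 : (reg 6).eval σ ((c'.setNat 6 0 j).tick 1) = j := by simp [NatExpr.eval]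
    have e3 : (NatExpr.read 3 (.read 4 (reg 6))).eval σ ((c'.setNat 6 0 j).tick 1) =
        center n (c.nat 3) (M j) := by
      rw [val_center (hc j)]
      simp [NatExpr.eval, k3, k4]
    rw [e6, e3, Config.ask_of_fin]
    refine ⟨fun j' hj' => ?_, fun a ha => ?_, fun a ha => ?_, fun j' => ?_, ?_⟩
    · rcases Nat.lt_or_ge j' j with h | h
      · rw [← hdone j' h]
        exact Config.real_setReal_index _ _ (by omega)
      · obtain rfl : j' = j := Fin.ext (by omega)
        exact Config.real_setReal_self _ _ _ _
    · exact (Config.real_setReal_array _ _ ha).trans (hreal a ha)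
    · exact (Config.nat_setNat_array _ _ ha).trans (hnat a ha)
    · have h := hq j'
      have hlog : (Config.tick { ((c'.setNat 6 0 j).tick 1).setReal 1 j
          (d j (center n (c.nat 3) (M j))) with
          log := (j, center n (c.nat 3) (M j)) :: ((c'.setNat 6 0 j).tick 1).log } 1).log =
          (j, center n (c.nat 3) (M j)) :: c'.log := rfl
      rw [Config.queriesTo, hlog, List.countP_cons]
      rw [Config.queriesTo] at h
      by_cases hjj : j = j'
      · subst hjj
        rw [if_neg (by omega)] at h
        rw [if_pos (by simp), if_pos (by omega)]
        omega
      · rw [if_neg (by simpa using hjj), Nat.add_zero]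
        refine h.trans (Nat.add_le_add_left ?_ _)
        split_ifs <;> omega
    · simp only [Config.steps_tick, Config.steps_setReal, Config.steps_setNat]
      omega
  · rintro c' ⟨hdone, hreal, hnat, hq, hsteps⟩
    rw [hn'] at hdone hsteps
    refine ⟨fun j => hdone j j.2, hreal, hnat, fun j => (hq j).trans ?_, hsteps⟩
    rw [hn', if_pos j.2]

/-- The invariant of the main loop after `t` rounds that opened the centers `s`. -/
structure KMeansInv (σ : Profile n) (d : PseudoMetric (Fin n) ℝ) (t : ℕ) (s : List (Fin n))
    (c : Config n) : Prop where
  size : c.nat 0 0 = n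
  acc : c.real 0 0 = 0
  valid : ∀ i < t, c.nat 3 i < n
  centers : centerList n (c.nat 3) t = s
  assigned : Assigned σ (c.nat 3) (c.nat 4) t
  weights : ∀ j : Fin n, c.real 1 j = distTo d s.toFinset j
  queries : ∀ j, c.queriesTo j ≤ t
  time : c.steps ≤ 1 + t * (4 + 6 * n)

theorem runs_kMeansRound_of_draw (hd : Consistent d σ) {t : ℕ} {s : List (Fin n)}
    (h : KMeansInv σ d t s c) (j : Fin n) :
    Runs σ d (.seq reassign measure)
      ((((c.setNat 5 0 t).tick 1).setNat 3 t j).tick (n + 1))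
      (KMeansInv σ d (t + 1) (s ++ [j])) := by
  set c₁ := (((c.setNat 5 0 t).tick 1).setNat 3 t j).tick (n + 1) with hc₁
  have h3t : c₁.nat 3 t = j := by simp [hc₁]
  have h3 : ∀ i < t, c₁.nat 3 i = c.nat 3 i := fun i hi => by
    rw [hc₁, Config.nat_tick, Config.nat_setNat_index _ _ (by omega)]
    simp
  have hvalid : ∀ i ≤ t, c₁.nat 3 i < n := fun i hi => by
    rcases Nat.lt_or_ge i t with h' | h'
    · rw [h3 i h']
      exact h.valid i h'
    · obtain rfl : i = t := by omega
      rw [h3t]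
      exact j.2
  have h4 : c₁.nat 4 = c.nat 4 := by simp [hc₁]
  have hA : Assigned σ (c₁.nat 3) (c₁.nat 4) t := by
    intro i
    obtain ⟨h1, h2⟩ := h.assigned i
    rw [h4]
    refine ⟨h1, fun i' hi => ?_⟩
    have := h2 i' hi
    rwa [center, center, h3 i' hi, h3 _ (by omega)]
  have hcl : centerList n (c₁.nat 3) (t + 1) = s ++ [j] := by
    rw [centerList_succ, centerList_congr h3, h.centers]
    congr 2
    exact Fin.ext ((val_center (hvalid t le_rfl)).trans h3t)
  refine Runs.seq ((runs_reassign (c := c₁) (t := t) (by simpa [hc₁] using h.size) (by simp [hc₁])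
    hvalid hA).mono ?_)
  rintro c₂ ⟨hA₂, hreal₂, hlog₂, hnat₂, hsteps₂⟩
  have k3 : c₂.nat 3 = c₁.nat 3 := hnat₂ 3 (by decide) (by decide)
  have k0 : c₂.nat 0 0 = n := by
    rw [hnat₂ 0 (by decide) (by decide)]
    simpa [hc₁] using h.size
  refine (runs_measure (c := c₂) k0 rfl fun i => ?_).mono ?_
  · rw [k3]
    have := (hA₂ i).1
    exact hvalid _ (by omega)
  rintro c₃ ⟨hdone, hreal₃, hnat₃, hq₃, hsteps₃⟩
  have m3 : c₃.nat 3 = c₁.nat 3 := (hnat₃ 3 (by decide)).trans k3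
  have hlog : c₂.log = c.log := hlog₂
  constructor
  · rw [hnat₃ 0 (by decide), k0]
  · rw [hreal₃ 0 (by decide), hreal₂]
    exact h.acc
  · rw [m3]
    exact fun i hi => hvalid i (by omega)
  · rw [m3, hcl]
  · rw [m3, hnat₃ 4 (by decide)]
    exact hA₂
  · intro i
    rw [hdone i, k3, ← hcl, hA₂.distTo_eq t.succ_pos hd]
  · intro i
    have h1 := hq₃ i
    have h2 := h.queries i
    rw [Config.queriesTo, Config.queriesTo, hlog] at h1
    rw [Config.queriesTo] at h2 ⊢
    omega
  · have h1 : c₁.steps = c.steps + 1 + (n + 1) := rfl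
    have h2 := h.time
    rw [Nat.succ_mul]
    omega

/-- The weights in memory define the distribution of the next center. -/
theorem KMeansInv.proportional_eq {t : ℕ} {s : List (Fin n)} (h : KMeansInv σ d t s c) :
    proportional (fun j : Fin n => c.real 1 j) =
      proportional (if s = [] then fun _ => 1 else distTo d s.toFinset) := by
  have hw : (fun j : Fin n => c.real 1 j) = distTo d s.toFinset := funext h.weights
  rw [hw]
  split_ifs with hs
  · -- by convention, `distTo d ∅` is `0`, and then the draw is uniform
    have h0 : distTo d ([] : List (Fin n)).toFinset = fun _ => 0 :=
      funext fun j => by simp [distTo]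
    rw [hs, h0, proportional_zero, proportional_one]
  · rfl

theorem coupled_loop (hd : Consistent d σ) (k l t : ℕ) :
    Coupled (kMeansPPLaw d t) (loopPMF σ d 5 kMeansRound (Config.init n k l) t)
      (KMeansInv σ d t) := by
  induction t with
  | zero =>
    refine Coupled.pure ⟨rfl, rfl, fun i hi => absurd hi (Nat.not_lt_zero _), rfl,
      fun j => ⟨Or.inl (by simp [Config.init]), fun i hi => absurd hi (Nat.not_lt_zero _)⟩,
      fun j => by simp [Config.init, distTo], fun j => le_rfl, by simp [Config.init]⟩
  | succ t ih =>
    refine ih.bind fun s c h => ?_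
    have e0 : (reg 0).eval σ ((c.setNat 5 0 t).tick 1) = n := by
      simpa [NatExpr.eval] using h.size
    have e5 : (reg 5).eval σ ((c.setNat 5 0 t).tick 1) = t := by simp [NatExpr.eval]
    rw [kMeansRound, Prog.exec, Prog.exec, e0, e5, drawIndex_eq, PMF.map_comp, PMF.bind_map]
    rw [show ((c.setNat 5 0 t).tick 1).real 1 = c.real 1 from rfl, h.proportional_eq]
    refine (Coupled.refl _).bind fun j j' hj => ?_
    obtain ⟨c', hc', hI⟩ := runs_kMeansRound_of_draw hd h j
    subst hj
    rw [Function.comp_apply, Function.comp_apply]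
    exact (congrArg (fun q => Coupled (PMF.pure (s ++ [j])) q _) hc').mpr (Coupled.pure hI)

/-- The run of the mechanism is coupled with the `k`-means++ rule. -/
theorem coupled_kMeansProg (hd : Consistent d σ) (k l : ℕ) :
    Coupled (kMeansPPLaw d k) (kMeansProg.run k l σ d) fun s c =>
      c.centers k = s.map Fin.val ∧ c.estimate = medianCost d s.toFinset ∧
        (∀ i : Fin n, c.queriesTo i ≤ k) ∧ c.steps ≤ 2 + k * (4 + 6 * n) + 2 * n := by
  rw [Prog.run, kMeansProg, Prog.exec, exec_forLoop, ← PMF.bind_pure (kMeansPPLaw d k)]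
  refine (coupled_loop hd k l k).bind fun s c h => ?_
  have hn : (reg 0).eval σ c = n := h.size
  have hrun : Runs σ d
      (.forLoop 6 (reg 0) (.setReal 0 (.lit 0) (.add (rreg 0) (.read 1 (reg 6))))) c fun c' =>
      c'.centers k = s.map Fin.val ∧ c'.estimate = medianCost d s.toFinset ∧
        (∀ i : Fin n, c'.queriesTo i ≤ k) ∧ c'.steps ≤ 2 + k * (4 + 6 * n) + 2 * n := by
    refine Runs.forLoop (fun m c' => c'.nat 3 = c.nat 3 ∧ c'.log = c.log ∧
      c'.real 1 = c.real 1 ∧ c'.real 0 0 = ∑ j ∈ Finset.range m, c.real 1 j ∧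
      c'.steps ≤ c.steps + 1 + 2 * m) ?_ ?_ ?_
    · exact ⟨rfl, rfl, rfl, by simpa using h.acc, le_rfl⟩
    · rintro m - c' ⟨h3, hlog, h1, h0, hsteps⟩
      refine Runs.setReal ⟨by simpa using h3, by simpa using hlog, by simpa using h1, ?_, ?_⟩
      · rw [Finset.sum_range_succ, ← h0, ← h1]
        simp [NatExpr.eval, RealExpr.eval]
      · simp only [Config.steps_tick, Config.steps_setNat, Config.steps_setReal]
        omega
    · rintro c' ⟨h3, hlog, -, h0, hsteps⟩
      rw [hn] at h0 hsteps
      refine ⟨?_, ?_, fun i => ?_, ?_⟩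
      · rw [← h.centers, map_val_centerList h.valid, Config.centers, h3]
      · rw [Config.estimate, h0, Finset.sum_range]
        exact Finset.sum_congr rfl fun j _ => h.weights j
      · rw [Config.queriesTo, hlog]
        exact h.queries i
      · have := h.time
        omega
  obtain ⟨c', hc', hQ⟩ := hrun
  rw [hc']
  exact Coupled.pure hQ

/-- The properties of the `k`-means++ mechanism, with explicit bounds. -/
theorem kMeansProg_spec (hd : Consistent d σ) {k l : ℕ} (hk : 1 ≤ k) (hl : 1 ≤ l) (hln : l ≤ n) :
    (kMeansProg.run k l σ d).map (fun c => (c.centers k, c.estimate)) =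
        (kMeansPPLaw d k).map (fun s => (s.map Fin.val, medianCost d s.toFinset)) ∧
      (1 / 2 : ENNReal) ≤ (kMeansProg.run k l σ d).toOuterMeasure
        {c | opt d k l ≤ c.estimate ∧
          c.estimate ≤ 8 * (Real.log (k : ℝ) + 2) * ((n : ℝ) / (l : ℝ)) * opt d k l} ∧
      ∀ c ∈ (kMeansProg.run k l σ d).support,
        (∀ i : Fin n, c.queriesTo i ≤ k) ∧ c.steps ≤ 2 + k * (4 + 6 * n) + 2 * n := by
  have hcoup := coupled_kMeansProg hd k l
  have hmap := (hcoup.map_eq (u := fun s => (s.map Fin.val, medianCost d s.toFinset))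
    (v := fun c => (c.centers k, c.estimate)) fun s c h => by rw [h.1, h.2.1]).symm
  refine ⟨hmap, ?_, fun c hc => ?_⟩
  · have h := half_le_kMeansPPLaw d hk hl hln
    have hpre := congrArg (fun p : PMF (List ℕ × ℝ) => p.toOuterMeasure
      {x | opt d k l ≤ x.2 ∧
        x.2 ≤ 8 * (Real.log (k : ℝ) + 2) * ((n : ℝ) / (l : ℝ)) * opt d k l}) hmap
    simp only [PMF.toOuterMeasure_map_apply] at hpre
    exact h.trans_eq hpre.symm
  · obtain ⟨s, -, -, -, h⟩ := hcoup.exists_of_mem_support hc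
    exact h

end KMeansPPMechanism

end KClustering

end

open KClustering in
theorem mainTheorem9 :
    -- (a) the deterministic farthest-point mechanism
    (∃ (P : Prog) (T : Polynomial ℕ) (K : ℕ),
      ∀ (n k l : ℕ) [NeZero n], 1 ≤ k → 1 ≤ l → l ≤ n →
      ∀ (σ : Profile n) (d : PseudoMetric (Fin n) ℝ), Consistent d σ →
        ∃ (c : Config n) (s : List (Fin n)),
          P.run k l σ d = PMF.pure c ∧
          s.length = k ∧ IsFarthestPointRun d s ∧
          c.centers k = s.map Fin.val ∧
          c.estimate = (l : ℝ) * centerCost d s.toFinset ∧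
          opt d k l ≤ c.estimate ∧
          c.estimate ≤ 2 * (l : ℝ) * opt d k l ∧
          (∀ i : Fin n, c.queriesTo i ≤ K * k) ∧
          c.totalQueries ≤ K * k ^ 2 ∧
          c.steps ≤ T.eval (n + k)) ∧
    -- (b) the randomized k-means++ mechanism
    (∃ (P : Prog) (T : Polynomial ℕ) (K : ℕ),
      ∀ (n k l : ℕ) [NeZero n], 1 ≤ k → 1 ≤ l → l ≤ n →
      ∀ (σ : Profile n) (d : PseudoMetric (Fin n) ℝ), Consistent d σ →
        (P.run k l σ d).map (fun c => (c.centers k, c.estimate)) =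
          (kMeansPPLaw d k).map
            (fun s => (s.map Fin.val, medianCost d s.toFinset)) ∧
        (1 / 2 : ENNReal) ≤ (P.run k l σ d).toOuterMeasure
          {c | opt d k l ≤ c.estimate ∧
            c.estimate ≤
              8 * (Real.log (k : ℝ) + 2) * ((n : ℝ) / (l : ℝ)) * opt d k l} ∧
        ∀ c ∈ (P.run k l σ d).support,
          (∀ i : Fin n, c.queriesTo i ≤ K * k) ∧
          c.steps ≤ T.eval (n + k)) := by
  constructor
  · refine ⟨farthestPointProg, Polynomial.C 2 + Polynomial.X * (Polynomial.C 5 +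
      Polynomial.C 3 * Polynomial.X + Polynomial.X * (Polynomial.C 8 +
        Polynomial.C 4 * Polynomial.X)) + Polynomial.C 2 * Polynomial.X, 1, ?_⟩
    intro n k l _ hk hl hln σ d hd
    obtain ⟨c, s, h1, h2, h3, h4, h5, h6, h7, h8, h9, h10⟩ :=
      farthestPointProg_spec hd hk hl hln
    refine ⟨c, s, h1, h2, h3, h4, h5, h6, h7, by simpa using h8, by simpa using h9, ?_⟩
    simp only [Polynomial.eval_add, Polynomial.eval_mul, Polynomial.eval_C, Polynomial.eval_X]
    refine h10.trans ?_
    gcongr <;> omega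
  · refine ⟨kMeansProg, Polynomial.C 2 + Polynomial.X * (Polynomial.C 4 +
      Polynomial.C 6 * Polynomial.X) + Polynomial.C 2 * Polynomial.X, 1, ?_⟩
    intro n k l _ hk hl hln σ d hd
    obtain ⟨h1, h2, h3⟩ := kMeansProg_spec hd hk hl hln
    refine ⟨h1, h2, fun c hc => ⟨by simpa using (h3 c hc).1, (h3 c hc).2.trans ?_⟩⟩
    simp only [Polynomial.eval_add, Polynomial.eval_mul, Polynomial.eval_C, Polynomial.eval_X]
    gcongr <;> omega
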